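/- Let $N\ge 2$ and consider the problem $$\min\ f_1(x_1)+\cdots+f_N(x_N)\quad\text{s.t. } A_1x_1+\cdots+A_{N-1}x_{N-1}+x_N=b,\quad x_i\in\mathcal X_i\ (1\le i\le N-1),\quad x_N\in\mathbf R^p,$$ where $A_i\in\mathbf R^{p\times n_i}$, $b\in\mathbf R^p$, the sets $\mathcal X_i\subset\mathbf R^{n_i}$ are closed and convex, and $f_i:\mathbf R^{n_i}\to\mathbf R$ are closed convex functions (with $A_N=I$, $n_N=p$, $\mathcal X_N=\mathbf R^p$). Write $f(u)=\sum_{i=1}^N f_i(x_i)$ for $u=(x_1,\dots,x_N)$ and, for $\gamma>0$, $$\mathcal L_\gamma(x_1,\dots,x_N;\lambda)=f(u)-\Big\langle\lambda,\sum_{i=1}^N A_ix_i-b\Big\rangle+\frac\gamma2\Big\|\sum_{i=1}^N A_ix_i-b\Big\|^2 .$$ Assume (Scenario 2): $f_N$ is differentiable and $\nabla f_N$ is Lipschitz continuous with constant $L$; $\gamma>\sqrt2\,L$ and $\gamma>0$; $f_i$ is bounded below on $\mathcal X_i$ for $i=1,\dots,N$; $f_i+\mathbf 1_{\mathcal X_i}$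 is coercive for $i=1,\dots,N-1$ (where $\mathbf 1_{\mathcal X}$ is $0$ on $\mathcal X$ and $+\infty$ elsewhere); and $\mathcal L_\gamma$, as a function of $w=(x_1,\dots,x_N,\lambda)$ extended by $+\infty$ outside $\Omega=\mathcal X_1\times\cdots\times\mathcal X_N\times\mathbf R^p$, is a KL function. Here $F$ is a KL function if for each $w_0$ with $\partial F(w_0)\ne\emptyset$ ($\partial$ is the limiting subdifferential) there are $\eta\in(0,+\infty]$, a neighbourhood $U$ of $w_0$ and a continuous concave $\varphi:[0,\eta)\to[0,\infty)$ with $\varphi(0)=0$, $\varphi\in C^1(0,\eta)$, $\varphi'>0$ on $(0,\eta)$, such that $\varphi'(F(w)-F(w_0))\,\mathrm{dist}(0,\partial F(w))\ge1$ for all $w\in U$ with $F(w_0)<F(w)<F(w_0)+\eta$ (where $\mathrm{dist}(0,\emptyset)=+\infty$). Let $(x_1^k,\dots,x_N^k,\lambda^k)_{k\ge0}$ be generated by the unmodified multi-block ADMM from an arbitrary starting point: for $k\ge0$ and $i=1,\dots,N$ in this order, $$x_i^{k+1}\in\mathop{\rm argmin}_{x_i\in\mathcal X_i} f_i(x_i)+\frac\gamma2\Big\|\sum_{j<i}A_jx_j^{k+1}+A_ix_i+\sum_{j>i}A_jx_j^k-b-\frac1\gamma\lambda^k\Big\|^2,$$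 $$\lambda^{k+1}=\lambda^k-\gamma\Big(\sum_{j=1}^NA_jx_j^{k+1}-b\Big).$$ Let $\bar x_i^t=\frac1{t+1}\sum_{k=0}^t x_i^{k+1}$ and $\bar u^t=(\bar x_1^t,\dots,\bar x_N^t)$. Let $(u^*,\lambda^*)=(x_1^*,\dots,x_N^*,\lambda^*)$ be any solution of the optimality system: $x_i^*\in\mathcal X_i$, and $(x_i-x_i^*)^\top(g_i-A_i^\top\lambda^*)\ge0$ for all $x_i\in\mathcal X_i$ with some subgradient $g_i\in\partial(f_i+\mathbf 1_{\mathcal X_i})(x_i^*)$, for $i=1,\dots,N$; and $\sum_{i=1}^NA_ix_i^*=b$. Put $\rho=\|\lambda^*\|+1$. Then: 1. The trajectory has finite length $$G:=\sum_{k=0}^\infty\Big(\sum_{i=1}^{N-1}\|A_ix_i^k-A_ix_i^{k+1}\|+\|x_N^k-x_N^{k+1}\|+\|\lambda^k-\lambda^{k+1}\|\Big)<\infty,$$ and there is a constant $D$ with $\sum_{i=2}^{N-1}\|A_ix_i^*-A_ix_i^{k+1}\|\le D$ for all $k\ge0$. 2. For every such $D$ and every integer $t\ge0$, $$0\le f(\bar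 u^t)-f(u^*)+\rho\Big\|\sum_{i=1}^NA_i\bar x_i^t-b\Big\|\le\frac{C}{t+1},$$ $$C:=\frac{\rho^2+\|\lambda^0\|^2}{\gamma}+\frac\gamma2\Big\|\sum_{i=2}^{N-1}A_i(x_i^0-x_i^*)+(x_N^0-x_N^*)\Big\|^2+\gamma DG .$$ 3. Consequently an $\epsilon$-optimal solution is reached in $O(1/\epsilon)$ iterations: for every $\epsilon>0$ and every integer $t\ge0$ with $t+1\ge\rho C/\epsilon$, $$|f(\bar u^t)-f(u^*)|\le\epsilon\quad\text{and}\quad\Big\|\sum_{i=1}^NA_i\bar x_i^t-b\Big\|\le\epsilon .$$ -/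

import Mathlib

open Filter Topology
open scoped NNReal

noncomputable section

namespace KL

variable {W : Type*} [NormedAddCommGroup W] [InnerProductSpace ℝ W]

/-- The Fréchet (regular) subdifferential of an extended-real-valued function at `x`; it is empty
where the function is not finite. -/
def frechetSubdiff (f : W → EReal) (x : W) : Set W :=
  {v | f x ≠ ⊤ ∧ f x ≠ ⊥ ∧ ∀ ε : ℝ, 0 < ε → ∀ᶠ y in 𝓝 x,
    f x + ((inner ℝ v (y - x) - ε * ‖y - x‖ : ℝ) : EReal) ≤ f y}

/-- The limiting (Mordukhovich) subdifferential of an extended-real-valued function at `x`. -/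
def subdiff (f : W → EReal) (x : W) : Set W :=
  {v | f x ≠ ⊤ ∧ f x ≠ ⊥ ∧ ∃ (xs vs : ℕ → W), (∀ k, vs k ∈ frechetSubdiff f (xs k)) ∧
    Tendsto xs atTop (𝓝 x) ∧ Tendsto (fun k => f (xs k)) atTop (𝓝 (f x)) ∧
    Tendsto vs atTop (𝓝 v)}

/-- The class `Φ_η`, for `η ∈ (0, +∞]`: concave continuous functions `φ : [0, η) → [0, ∞)` with
`φ 0 = 0` that are `C¹` on `(0, η)` with positive derivative there. -/
structure IsDesingularizing (η : EReal) (φ : ℝ → ℝ) : Prop where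
  concave : ConcaveOn ℝ {s : ℝ | 0 ≤ s ∧ (s : EReal) < η} φ
  continuous : ContinuousOn φ {s : ℝ | 0 ≤ s ∧ (s : EReal) < η}
  nonneg : ∀ s : ℝ, 0 ≤ s → (s : EReal) < η → 0 ≤ φ s
  zero : φ 0 = 0
  contDiff : ContDiffOn ℝ 1 φ {s : ℝ | 0 < s ∧ (s : EReal) < η}
  deriv_pos : ∀ s : ℝ, 0 < s → (s : EReal) < η → 0 < deriv φ s

/-- The Kurdyka–Łojasiewicz property of `f` at a point `w₀` (meant for points where the
subdifferential is nonempty, so that `f w₀` is finite). The distance from `0` to the empty set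
is `∞`. -/
def HasKLPropertyAt (f : W → EReal) (w₀ : W) : Prop :=
  ∃ η : EReal, 0 < η ∧ ∃ U ∈ 𝓝 w₀, ∃ φ : ℝ → ℝ, IsDesingularizing η φ ∧
    ∀ w ∈ U, f w₀ < f w → f w < f w₀ + η →
      1 ≤ ENNReal.ofReal (deriv φ ((f w).toReal - (f w₀).toReal)) *
        Metric.infEDist 0 (subdiff f w)

/-- `f` is a KL function: it has the KL property at every point of the domain of `∂f`. -/
def IsKLFunction (f : W → EReal) : Prop :=
  ∀ w₀, (subdiff f w₀).Nonempty → HasKLPropertyAt f w₀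

end KL

/-- The data of the problem with `N = m + 2` blocks
`min f_1(x_1) + ⋯ + f_{N-1}(x_{N-1}) + f_N(x_N)` subject to
`A_1 x_1 + ⋯ + A_{N-1} x_{N-1} + x_N = b`, `x_i ∈ X_i` for `i < N`, `x_N ∈ ℝ^p`.
The blocks `1, …, N-1` are indexed by `Fin (m + 1)`, the last block is kept apart. -/
structure SharingProblem (m p : ℕ) (n : Fin (m + 1) → ℕ) where
  f : (i : Fin (m + 1)) → EuclideanSpace ℝ (Fin (n i)) → ℝ
  X : (i : Fin (m + 1)) → Set (EuclideanSpace ℝ (Fin (n i)))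
  A : (i : Fin (m + 1)) → EuclideanSpace ℝ (Fin (n i)) →L[ℝ] EuclideanSpace ℝ (Fin p)
  fN : EuclideanSpace ℝ (Fin p) → ℝ
  b : EuclideanSpace ℝ (Fin p)

namespace SharingProblem

variable {m p : ℕ} {n : Fin (m + 1) → ℕ}

/-- The objective `f(u) = f_1(x_1) + ⋯ + f_N(x_N)` at `u = (x, y)` with `y = x_N`. -/
def objective (P : SharingProblem m p n) (x : (i : Fin (m + 1)) → EuclideanSpace ℝ (Fin (n i)))
    (y : EuclideanSpace ℝ (Fin p)) : ℝ :=
  ∑ i, P.f i (x i) + P.fN y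

/-- The residual `A_1 x_1 + ⋯ + A_{N-1} x_{N-1} + x_N - b` of the coupling constraint. -/
def residual (P : SharingProblem m p n) (x : (i : Fin (m + 1)) → EuclideanSpace ℝ (Fin (n i)))
    (y : EuclideanSpace ℝ (Fin p)) : EuclideanSpace ℝ (Fin p) :=
  ∑ i, P.A i (x i) + y - P.b

/-- The augmented Lagrangian `L_γ(x_1, …, x_N; λ)`. -/
def augLagrangian (P : SharingProblem m p n) (γ : ℝ)
    (x : (i : Fin (m + 1)) → EuclideanSpace ℝ (Fin (n i)))
    (y lam : EuclideanSpace ℝ (Fin p)) : ℝ :=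
  P.objective x y - inner ℝ lam (P.residual x y) + γ / 2 * ‖P.residual x y‖ ^ 2

open Classical in
/-- The augmented Lagrangian as an extended-real-valued function of `w = (x_1, …, x_N, λ)` in the
Euclidean space `ℝ^{n_1} × ⋯ × ℝ^{n_{N-1}} × ℝ^p × ℝ^p`: it is `+∞` outside
`X_1 × ⋯ × X_{N-1} × ℝ^p × ℝ^p`. -/
def extLagrangian (P : SharingProblem m p n) (γ : ℝ)
    (w : WithLp 2 (PiLp 2 (fun i : Fin (m + 1) => EuclideanSpace ℝ (Fin (n i))) ×
      WithLp 2 (EuclideanSpace ℝ (Fin p) × EuclideanSpace ℝ (Fin p)))) : EReal :=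
  if ∀ i, w.fst i ∈ P.X i then
    ((P.augLagrangian γ (fun i => w.fst i) w.snd.fst w.snd.snd : ℝ) : EReal)
  else ⊤

/-- The standing assumptions on the problem together with the conditions of Scenario 2;
`L` is a Lipschitz constant of `∇ f_N`. -/
structure Scenario2 (P : SharingProblem m p n) (γ : ℝ) (L : ℝ≥0) : Prop where
  closed_X : ∀ i, IsClosed (P.X i)
  convex_X : ∀ i, Convex ℝ (P.X i)
  closed_f : ∀ i, LowerSemicontinuous (P.f i)
  convex_f : ∀ i, ConvexOn ℝ Set.univ (P.f i)
  convex_fN : ConvexOn ℝ Set.univ P.fN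
  differentiable_fN : Differentiable ℝ P.fN
  lipschitz_fN : LipschitzWith L (gradient P.fN)
  gamma_gt : Real.sqrt 2 * (L : ℝ) < γ
  bddBelow_f : ∀ i, BddBelow (P.f i '' P.X i)
  bddBelow_fN : BddBelow (Set.range P.fN)
  coercive_f : ∀ i, Tendsto (P.f i) (Bornology.cobounded _ ⊓ 𝓟 (P.X i)) atTop
  isKL : KL.IsKLFunction (P.extLagrangian γ)

/-- `(x^k, y^k, λ^k)`, with `y^k = x_N^k`, is generated by the multi-block ADMM from
`(x^0, y^0, λ^0)`. Every argmin is some minimizer, which need not be unique. -/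
structure IsADMM (P : SharingProblem m p n) (γ : ℝ)
    (x : ℕ → (i : Fin (m + 1)) → EuclideanSpace ℝ (Fin (n i)))
    (y lam : ℕ → EuclideanSpace ℝ (Fin p)) : Prop where
  mem : ∀ k i, x (k + 1) i ∈ P.X i
  update_x : ∀ k i, IsMinOn (fun z => P.f i z + γ / 2 *
    ‖∑ j ∈ Finset.Iio i, P.A j (x (k + 1) j) + P.A i z + ∑ j ∈ Finset.Ioi i, P.A j (x k j)
      + y k - P.b - (1 / γ) • lam k‖ ^ 2) (P.X i) (x (k + 1) i)
  update_y : ∀ k, IsMinOn (fun z => P.fN z + γ / 2 *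
    ‖∑ j, P.A j (x (k + 1) j) + z - P.b - (1 / γ) • lam k‖ ^ 2) Set.univ (y (k + 1))
  update_lam : ∀ k, lam (k + 1) = lam k - γ • P.residual (x (k + 1)) (y (k + 1))

/-- The optimality condition of one block with objective `f`, constraint set `X` and constraint
matrix `A`: `x ∈ X` and `(z - x)ᵀ (g - Aᵀ λ) ≥ 0` for all `z ∈ X`, where `g` is a subgradient of
`f + 1_X` at `x`. -/
def BlockOptimal {q : ℕ} (f : EuclideanSpace ℝ (Fin q) → ℝ) (X : Set (EuclideanSpace ℝ (Fin q)))
    (A : EuclideanSpace ℝ (Fin q) →L[ℝ] EuclideanSpace ℝ (Fin p))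
    (x : EuclideanSpace ℝ (Fin q)) (lam : EuclideanSpace ℝ (Fin p)) : Prop :=
  x ∈ X ∧ ∃ g : EuclideanSpace ℝ (Fin q), (∀ z ∈ X, f x + inner ℝ g (z - x) ≤ f z) ∧
    ∀ z ∈ X, 0 ≤ inner ℝ (z - x) (g - ContinuousLinearMap.adjoint A lam)

/-- `(x, y, λ) ∈ Ω*`: the first-order optimality (KKT) system of the problem. -/
structure IsKKT (P : SharingProblem m p n) (x : (i : Fin (m + 1)) → EuclideanSpace ℝ (Fin (n i)))
    (y lam : EuclideanSpace ℝ (Fin p)) : Prop where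
  block : ∀ i, BlockOptimal (P.f i) (P.X i) (P.A i) (x i) lam
  last : BlockOptimal P.fN Set.univ (ContinuousLinearMap.id ℝ _) y lam
  feasible : P.residual x y = 0

/-- The ergodic average `(1 / (t + 1)) ∑_{k = 0}^{t} z^{k+1}`. -/
def ergodicAvg {E : Type*} [AddCommGroup E] [Module ℝ E] (z : ℕ → E) (t : ℕ) : E :=
  (1 / ((t : ℝ) + 1)) • ∑ k ∈ Finset.range (t + 1), z (k + 1)

/-- The length of the `k`-th step,
`∑_{i<N} ‖A_i x_i^k - A_i x_i^{k+1}‖ + ‖x_N^k - x_N^{k+1}‖ + ‖λ^k - λ^{k+1}‖`. -/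
def stepLength (P : SharingProblem m p n)
    (x : ℕ → (i : Fin (m + 1)) → EuclideanSpace ℝ (Fin (n i)))
    (y lam : ℕ → EuclideanSpace ℝ (Fin p)) (k : ℕ) : ℝ :=
  ∑ i, ‖P.A i (x k i) - P.A i (x (k + 1) i)‖ + ‖y k - y (k + 1)‖ + ‖lam k - lam (k + 1)‖

end SharingProblem

end

/-!
The proof has two parts; the second uses the first only through the finiteness of the length.

**Finite length.** The optimality conditions of the block updates say that, for
`q_i = ∑_{j > i} A_j (x_j^{k+1} - x_j^k) + x_N^{k+1} - x_N^k`, the vector `A_iᵀ (λ^{k+1} + γ q_i)` is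
a subgradient of `f_i + 1_{X_i}` at `x_i^{k+1}` (`IsADMM.block_le`, `IsADMM.last_le`); for the last
block this gives `λ^{k+1} = ∇f_N(x_N^{k+1})`, so multiplier steps are dominated by `L` times steps of
`x_N`. Since `γ > √2 L`, the augmented Lagrangian then decreases by a multiple of the squared step
length (`IsADMM.exists_sufficient_decrease`). It is bounded below by the descent lemma, and
coercivity bounds the iterates (`IsADMM.exists_norm_le`). The same optimality conditions provide a
Fréchet subgradient of the extended augmented Lagrangian of norm at most a multiple of the preceding
step length (`IsADMM.subgrad_mem`, `IsADMM.norm_subgrad_le`).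

The steps are measured by `‖A_i x_i^k - A_i x_i^{k+1}‖` and the `A_i` need not be injective, so a
short trajectory cannot be trapped in the KL neighbourhood of a single limit point. Instead, the
estimate `c a_{k+1}² ≤ M a_k (θ_k - θ_{k+1})`, with `θ` nonnegative and antitone, is proved near each
point of a compact set that contains the iterates, and glued by compactness: estimates on two sets
give one on their union, with the sum of the two sequences `θ`
(`KL.IsKLFunction.summable_steps`).

**Ergodic rate.** Summing the optimality conditions against a solution bounds the Lagrangian gap
`f(u^{k+1}) - f(u^*) - ⟨μ, r^{k+1}⟩`, where `r` is the residual and `μ` an arbitrary multiplier, by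
two telescoping terms and `γ D` times the step length (`IsADMM.objective_sub_le`). Averaging, with
convexity of the objective and finiteness of the length, and taking `μ` of norm at most `ρ` opposite
to the averaged residual gives the upper bound; duality at the KKT point
(`IsKKT.inner_residual_le`) gives the lower one.
-/

noncomputable section

/-! ### First-order facts about convex and smooth functions -/

section Convex

variable {E F : Type*} [NormedAddCommGroup E] [InnerProductSpace ℝ E]
  [NormedAddCommGroup F] [InnerProductSpace ℝ F]

/-- The first-order optimality condition for minimizing `f + (γ/2)‖B · + c‖²` over a convex set,
in its strong form: it produces a subgradient of `f + 1_X` at the minimizer. -/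
theorem ConvexOn.add_inner_le_of_isMinOn_add_sq {f : E → ℝ} {X : Set E} (hf : ConvexOn ℝ X f)
    {B : E →L[ℝ] F} {c : F} {γ : ℝ} {x₀ : E} (hx₀ : x₀ ∈ X)
    (hmin : IsMinOn (fun z => f z + γ / 2 * ‖B z + c‖ ^ 2) X x₀) {z : E} (hz : z ∈ X) :
    f x₀ + inner ℝ (-(γ • (B x₀ + c))) (B (z - x₀)) ≤ f z := by
  set q := B x₀ + c with hq
  set d := B (z - x₀) with hd
  have key : ∀ t ∈ Set.Ioc (0 : ℝ) 1,
      0 ≤ f z - f x₀ + γ * inner ℝ q d + t * (γ / 2 * ‖d‖ ^ 2) := by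
    rintro t ⟨ht0, ht1⟩
    have hmem : (1 - t) • x₀ + t • z ∈ X := hf.1 hx₀ hz (by linarith) ht0.le (by ring)
    have h1 := hmin hmem
    have h2 := hf.2 hx₀ hz (by linarith : (0 : ℝ) ≤ 1 - t) ht0.le (by ring)
    have h3 : B ((1 - t) • x₀ + t • z) + c = q + t • d := by
      have : (1 - t) • x₀ + t • z = x₀ + t • (z - x₀) := by module
      rw [this, map_add, map_smul, hq, hd]; abel
    have h4 : ‖q + t • d‖ ^ 2 = ‖q‖ ^ 2 + 2 * (t * inner ℝ q d) + t ^ 2 * ‖d‖ ^ 2 := by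
      rw [norm_add_sq_real, inner_smul_right, norm_smul, mul_pow, Real.norm_eq_abs, sq_abs]
    simp only [Set.mem_ofPred_eq, h3, h4, smul_eq_mul] at h1 h2
    have h5 : 0 ≤ t * (f z - f x₀ + γ * inner ℝ q d + t * (γ / 2 * ‖d‖ ^ 2)) := by
      nlinarith
    exact nonneg_of_mul_nonneg_right h5 ht0
  have hlim : Tendsto (fun t : ℝ => f z - f x₀ + γ * inner ℝ q d + t * (γ / 2 * ‖d‖ ^ 2))
      (𝓝[>] 0) (𝓝 (f z - f x₀ + γ * inner ℝ q d + 0 * (γ / 2 * ‖d‖ ^ 2))) := by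
    refine Tendsto.mono_left ?_ nhdsWithin_le_nhds
    exact (Continuous.tendsto (by fun_prop) 0)
  have h0 := ge_of_tendsto hlim
    (Filter.mem_of_superset (Ioc_mem_nhdsGT (zero_lt_one' ℝ)) key)
  rw [inner_neg_left, real_inner_smul_left]
  linarith

variable [CompleteSpace E]

theorem gradient_eq_of_forall_add_inner_le {f : E → ℝ} {y v : E} (hf : DifferentiableAt ℝ f y)
    (h : ∀ z, f y + inner ℝ v (z - y) ≤ f z) : gradient f y = v := by
  have h1 : HasFDerivAt (fun z => f z - inner ℝ v z) (fderiv ℝ f y - innerSL ℝ v) y :=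
    hf.hasFDerivAt.sub (innerSL ℝ v).hasFDerivAt
  have h2 : IsLocalMin (fun z => f z - inner ℝ v z) y := by
    refine Filter.Eventually.of_forall fun z => ?_
    have := h z
    rw [inner_sub_right] at this
    linarith
  have h3 := sub_eq_zero.1 (h2.hasFDerivAt_eq_zero h1)
  rw [gradient, h3]
  exact (InnerProductSpace.toDual ℝ E).symm_apply_apply v

/-- The descent lemma. -/
theorem le_add_inner_gradient_add_sq {f : E → ℝ} {L : ℝ≥0} (hf : Differentiable ℝ f)
    (hL : LipschitzWith L (gradient f)) (x d : E) :
    f (x + d) ≤ f x + inner ℝ (gradient f x) d + L / 2 * ‖d‖ ^ 2 := by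
  set g : ℝ → ℝ := fun t => f (x + t • d) - t * inner ℝ (gradient f x) d
    - L / 2 * t ^ 2 * ‖d‖ ^ 2 with hg
  have hder : ∀ t : ℝ, HasDerivAt g (inner ℝ (gradient f (x + t • d)) d
      - inner ℝ (gradient f x) d - L * t * ‖d‖ ^ 2) t := by
    intro t
    have h1 : HasDerivAt (fun t : ℝ => x + t • d) d t := by
      simpa using ((hasDerivAt_id t).smul_const d).const_add x
    have h2 : HasDerivAt (fun t : ℝ => f (x + t • d)) (inner ℝ (gradient f (x + t • d)) d) t := by
      have h3 := (hf (x + t • d)).hasGradientAt.hasFDerivAt.comp_hasDerivAt t h1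
      simpa [Function.comp_def] using h3
    have h4 := (h2.sub ((hasDerivAt_id t).mul_const (inner ℝ (gradient f x) d))).sub
      ((((hasDerivAt_id t).pow 2).const_mul ((L : ℝ) / 2)).mul_const (‖d‖ ^ 2))
    refine h4.congr_deriv ?_
    simp only [id, Nat.cast_ofNat]
    ring
  have hanti : AntitoneOn g (Set.Ici 0) := by
    refine antitoneOn_of_deriv_nonpos (convex_Ici 0)
      (fun t _ => (hder t).continuousAt.continuousWithinAt)
      (fun t _ => (hder t).differentiableAt.differentiableWithinAt) fun t ht => ?_
    rw [interior_Ici] at ht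
    have ht0 : 0 < t := ht
    rw [(hder t).deriv, ← inner_sub_left]
    have h1 := real_inner_le_norm (gradient f (x + t • d) - gradient f x) d
    have h2 := hL.dist_le_mul (x + t • d) x
    rw [dist_eq_norm, dist_eq_norm, add_sub_cancel_left, norm_smul, Real.norm_eq_abs,
      abs_of_pos ht0] at h2
    have h3 := mul_le_mul_of_nonneg_right h2 (norm_nonneg d)
    nlinarith
  have := hanti (Set.mem_Ici.2 le_rfl) (Set.mem_Ici.2 zero_le_one) zero_le_one
  simp only [hg, one_smul, zero_smul, add_zero, one_pow] at this
  linarith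

end Convex

/-! ### Convergence of descent sequences for KL functions -/

/-- If each step is at most the geometric mean of the preceding one and of the decrements of a
nonnegative sequence, the steps are summable. -/
theorem summable_of_sq_le_mul_sub {a θ : ℕ → ℝ} {c M : ℝ} (hc : 0 < c) (hM : 0 ≤ M)
    (ha : ∀ k, 0 ≤ a k)
    (h : ∀ᶠ k in atTop, 0 ≤ θ k ∧ θ (k + 1) ≤ θ k ∧
      c * a (k + 1) ^ 2 ≤ M * a k * (θ k - θ (k + 1))) : Summable a := by
  obtain ⟨k₀, hk₀⟩ := eventually_atTop.1 h
  have step : ∀ k, k₀ ≤ k → 2 * a (k + 1) ≤ a k + M / c * (θ k - θ (k + 1)) := by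
    intro k hk
    obtain ⟨-, h2, h3⟩ := hk₀ k hk
    have hs : 0 ≤ M / c * (θ k - θ (k + 1)) := by
      have := sub_nonneg.2 h2
      positivity
    have h4 : a (k + 1) ^ 2 ≤ a k * (M / c * (θ k - θ (k + 1))) := by
      have : a k * (M / c * (θ k - θ (k + 1))) = (M * a k * (θ k - θ (k + 1))) / c := by ring
      rw [this, le_div_iff₀ hc]
      linarith
    have h5 := ha k
    refine le_of_sq_le_sq ?_ (by linarith)
    nlinarith [sq_nonneg (a k - M / c * (θ k - θ (k + 1)))]
  rw [← summable_nat_add_iff k₀]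
  refine summable_of_sum_range_le (c := 2 * a k₀ + M / c * θ k₀) (fun k => ha _) fun t => ?_
  have hind : ∀ t, ∑ k ∈ Finset.range t, a (k + k₀) + a (t + k₀)
      ≤ 2 * a k₀ + M / c * (θ k₀ - θ (t + k₀)) := by
    intro t
    have : ∀ t, ∑ k ∈ Finset.range t, a (k + k₀) + 2 * a (t + k₀)
        ≤ 2 * a k₀ + M / c * (θ k₀ - θ (t + k₀)) := by
      intro t
      induction t with
      | zero => simp
      | succ t ih =>
        rw [Finset.sum_range_succ]
        have := step (t + k₀) (by omega)
        rw [show t + 1 + k₀ = t + k₀ + 1 by omega]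
        nlinarith
    linarith [this t, ha (t + k₀)]
  have h1 := hind t
  have h2 := (hk₀ (t + k₀) (by omega)).1
  have h3 := ha (t + k₀)
  have h4 : 0 ≤ M / c * θ (t + k₀) := by positivity
  nlinarith

namespace KL

variable {W : Type*} [NormedAddCommGroup W] [InnerProductSpace ℝ W]

/-- The tangent inequality for a desingularizing function. -/
theorem IsDesingularizing.deriv_mul_sub_le {η : EReal} {φ : ℝ → ℝ} (hφ : IsDesingularizing η φ)
    {s t : ℝ} (ht : 0 ≤ t) (hts : t ≤ s) (hs : 0 < s) (hsη : (s : EReal) < η) :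
    deriv φ s * (s - t) ≤ φ s - φ t := by
  rcases hts.eq_or_lt with rfl | hlt
  · simp
  have hopen : IsOpen {s : ℝ | 0 < s ∧ (s : EReal) < η} :=
    (isOpen_lt continuous_const continuous_id).inter
      (isOpen_lt continuous_coe_real_ereal continuous_const)
  have hd : DifferentiableAt ℝ φ s :=
    (hφ.contDiff.differentiableOn one_ne_zero).differentiableAt (hopen.mem_nhds ⟨hs, hsη⟩)
  have h := hφ.concave.deriv_le_slope
    (x := t) (y := s) ⟨ht, lt_of_le_of_lt (EReal.coe_le_coe_iff.2 hts) hsη⟩ ⟨hs.le, hsη⟩ hlt hd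
  rw [slope_def_field, le_div_iff₀ (sub_pos.2 hlt)] at h
  exact h

theorem frechetSubdiff_subset_subdiff (f : W → EReal) (x : W) :
    frechetSubdiff f x ⊆ subdiff f x := fun v hv =>
  ⟨hv.1, hv.2.1, fun _ => x, fun _ => v, fun _ => hv, tendsto_const_nhds, tendsto_const_nhds,
    tendsto_const_nhds⟩

/-- A proximal-type lower bound is enough for a Fréchet subgradient. -/
theorem mem_frechetSubdiff_of_sq {f : W → EReal} {x v : W} {r K : ℝ} (hfx : f x = (r : EReal))
    (hK : 0 ≤ K) (h : ∀ z, ((r + inner ℝ v (z - x) - K * ‖z - x‖ ^ 2 : ℝ) : EReal) ≤ f z) :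
    v ∈ frechetSubdiff f x := by
  refine ⟨by simp [hfx], by simp [hfx], fun ε hε => ?_⟩
  have hball : Metric.ball x (ε / (K + 1)) ∈ 𝓝 x := Metric.ball_mem_nhds _ (by positivity)
  filter_upwards [hball] with z hz
  rw [mem_ball_iff_norm, lt_div_iff₀ (by positivity)] at hz
  refine le_trans ?_ (h z)
  rw [hfx, ← EReal.coe_add, EReal.coe_le_coe_iff]
  have h1 : K * ‖z - x‖ ≤ ε := by nlinarith [norm_nonneg (z - x)]
  have h2 := mul_le_mul_of_nonneg_right h1 (norm_nonneg (z - x))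
  nlinarith

/-- The KL inequality near `x`, read along a descent sequence: near `x` each step of the sequence
is controlled by the preceding one and by the decrement of a nonnegative antitone sequence, namely
`φ (f (w (k + 1)) - f x)`. -/
theorem HasKLPropertyAt.exists_decrement {f : W → EReal} {x : W} (hKL : HasKLPropertyAt f x)
    {w v : ℕ → W} {a r : ℕ → ℝ} {c M l : ℝ} (hc : 0 < c) (hM : 0 ≤ M) (ha : ∀ k, 0 ≤ a k)
    (hf : ∀ k, f (w k) = (r k : EReal)) (hfx : f x = (l : EReal))
    (hv : ∀ k, v k ∈ frechetSubdiff f (w k)) (hva : ∀ k, ‖v (k + 1)‖ ≤ M * a k)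
    (hdec : ∀ k, r (k + 1) + c * a k ^ 2 ≤ r k) (hr : Tendsto r atTop (𝓝 l)) :
    ∃ U ∈ 𝓝 x, ∃ θ : ℕ → ℝ, ∀ᶠ k in atTop, 0 ≤ θ k ∧ θ (k + 1) ≤ θ k ∧
      (w (k + 1) ∈ U → c * a (k + 1) ^ 2 ≤ M * a k * (θ k - θ (k + 1))) := by
  obtain ⟨η, hη, U, hU, φ, hφ, hineq⟩ := hKL
  have hanti : Antitone r := antitone_nat_of_succ_le fun k => by
    have := hdec k
    have : 0 ≤ c * a k ^ 2 := by positivity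
    linarith
  have hlr : ∀ k, l ≤ r k := fun k => hanti.le_of_tendsto hr k
  obtain ⟨q, hq0, hqη⟩ := EReal.lt_iff_exists_real_btwn.1 hη
  have hq0' : (0 : ℝ) < q := by exact_mod_cast hq0
  refine ⟨U, hU, fun k => φ (r (k + 1) - l), ?_⟩
  have hev : ∀ᶠ k in atTop, r k < l + q := hr.eventually_lt_const (by linarith)
  filter_upwards [hev] with k hk
  have hs : ∀ j, k ≤ j → ((r j - l : ℝ) : EReal) < η := fun j hj =>
    lt_of_lt_of_le (EReal.coe_lt_coe_iff.2 (by linarith [hanti hj])) hqη.le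
  have htan : 0 < r (k + 1) - l → deriv φ (r (k + 1) - l) * (r (k + 1) - r (k + 2))
      ≤ φ (r (k + 1) - l) - φ (r (k + 2) - l) := by
    intro hpos
    have := hφ.deriv_mul_sub_le (s := r (k + 1) - l) (t := r (k + 2) - l)
      (by linarith [hlr (k + 2)]) (by linarith [hanti (show k + 1 ≤ k + 2 by omega)]) hpos
      (hs _ (by omega))
    simpa using this
  have h12 := hanti (show k + 1 ≤ k + 2 by omega)
  refine ⟨hφ.nonneg _ (by linarith [hlr (k + 1)]) (hs _ (by omega)), ?_, fun hwU => ?_⟩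
  · rcases (sub_nonneg.2 (hlr (k + 1))).eq_or_lt with h0 | hpos
    · have h2 : r (k + 2) - l = r (k + 1) - l := by linarith [hlr (k + 2)]
      exact le_of_eq (congrArg φ h2)
    · have h1 := htan hpos
      have h2 := (hφ.deriv_pos _ hpos (hs _ (by omega))).le
      have h3 : 0 ≤ deriv φ (r (k + 1) - l) * (r (k + 1) - r (k + 2)) :=
        mul_nonneg h2 (by linarith)
      change φ (r (k + 2) - l) ≤ φ (r (k + 1) - l)
      linarith
  · have hd := hdec (k + 1)
    rcases (sub_nonneg.2 (hlr (k + 1))).eq_or_lt with h0 | hpos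
    · have h2 : r (k + 2) - l = r (k + 1) - l := by linarith [hlr (k + 2)]
      have h3 : φ (r (k + 1 + 1) - l) = φ (r (k + 1) - l) := congrArg φ h2
      simp only [h3, sub_self, mul_zero]
      have h4 : r (k + 1 + 1) = r (k + 2) := rfl
      linarith
    · have hp := hφ.deriv_pos _ hpos (hs _ (by omega))
      have h1 := hineq (w (k + 1)) hwU
        (by rw [hf, hfx]; exact EReal.coe_lt_coe_iff.2 (by linarith))
        (by
          rw [hf, hfx]
          have := EReal.add_lt_add_left_coe (hs (k + 1) (by omega)) l
          rwa [← EReal.coe_add, add_sub_cancel] at this)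
      rw [hf, hfx, EReal.toReal_coe, EReal.toReal_coe] at h1
      have h2 : Metric.infEDist 0 (subdiff f (w (k + 1))) ≤ ENNReal.ofReal ‖v (k + 1)‖ := by
        refine (Metric.infEDist_le_edist_of_mem
          (frechetSubdiff_subset_subdiff _ _ (hv (k + 1)))).trans_eq ?_
        rw [edist_comm, edist_zero_right, ofReal_norm]
      have h3 : (1 : ℝ) ≤ deriv φ (r (k + 1) - l) * ‖v (k + 1)‖ := by
        have h4 := h1.trans (mul_le_mul_right h2 _)
        rw [← ENNReal.ofReal_mul hp.le, ENNReal.one_le_ofReal] at h4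
        exact h4
      have h5 : 1 ≤ deriv φ (r (k + 1) - l) * (M * a k) :=
        h3.trans (mul_le_mul_of_nonneg_left (hva k) hp.le)
      have h6 := htan hpos
      have h7 : c * a (k + 1) ^ 2 ≤ r (k + 1) - r (k + 2) := by
        have h4 : r (k + 1 + 1) = r (k + 2) := rfl
        linarith
      have h8 : 0 ≤ c * a (k + 1) ^ 2 := by positivity
      have h9 : 0 ≤ M * a k := mul_nonneg hM (ha k)
      calc c * a (k + 1) ^ 2
          ≤ (deriv φ (r (k + 1) - l) * (M * a k)) * (c * a (k + 1) ^ 2) :=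
            le_mul_of_one_le_left h8 h5
        _ = (M * a k) * (deriv φ (r (k + 1) - l) * (c * a (k + 1) ^ 2)) := by ring
        _ ≤ (M * a k) * (deriv φ (r (k + 1) - l) * (r (k + 1) - r (k + 2))) := by gcongr
        _ ≤ (M * a k) * (φ (r (k + 1) - l) - φ (r (k + 1 + 1) - l)) := by gcongr

/-- A descent sequence with relative error bounds for a KL function, in a compact set on which the
function is continuous, has summable steps. The steps `a k` need not bound `‖w k - w (k + 1)‖`, so
the sequence cannot be trapped near one limit point; instead the local estimates are glued over
the compact set by adding up the finitely many decrement sequences. -/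
theorem IsKLFunction.summable_steps {f : W → EReal} (hKL : IsKLFunction f)
    {w v : ℕ → W} {a r : ℕ → ℝ} {c M : ℝ} {S : Set W} (hS : IsCompact S)
    (hfS : ContinuousOn f S) (hwS : ∀ k, w k ∈ S) (hc : 0 < c) (hM : 0 ≤ M) (ha : ∀ k, 0 ≤ a k)
    (hf : ∀ k, f (w k) = (r k : EReal))
    (hv : ∀ k, v k ∈ frechetSubdiff f (w k)) (hva : ∀ k, ‖v (k + 1)‖ ≤ M * a k)
    (hdec : ∀ k, r (k + 1) + c * a k ^ 2 ≤ r k) (hbdd : BddBelow (Set.range r)) :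
    Summable a := by
  have hanti : Antitone r := antitone_nat_of_succ_le fun k => by
    have := hdec k
    have : 0 ≤ c * a k ^ 2 := by positivity
    linarith
  obtain ⟨l, hl⟩ : ∃ l, Tendsto r atTop (𝓝 l) := ⟨_, tendsto_atTop_ciInf hanti hbdd⟩
  have ha0 : Tendsto a atTop (𝓝 0) := by
    have h1 : Tendsto (fun k => (r k - r (k + 1)) / c) atTop (𝓝 ((l - l) / c)) :=
      (hl.sub (hl.comp (tendsto_add_atTop_nat 1))).div_const c
    rw [sub_self, zero_div] at h1
    have h2 : Tendsto (fun k => a k ^ 2) atTop (𝓝 0) :=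
      squeeze_zero (fun k => sq_nonneg _)
        (fun k => by rw [le_div_iff₀ hc]; linarith [hdec k]) h1
    have h3 := h2.sqrt
    simpa [Real.sqrt_sq (ha _)] using h3
  have hv0 : Tendsto v atTop (𝓝 0) := by
    rw [← tendsto_add_atTop_iff_nat 1]
    refine squeeze_zero_norm hva ?_
    simpa using ha0.const_mul M
  have hcover : ∃ θ : ℕ → ℝ, ∀ᶠ k in atTop, 0 ≤ θ k ∧ θ (k + 1) ≤ θ k ∧
      (w (k + 1) ∈ S → c * a (k + 1) ^ 2 ≤ M * a k * (θ k - θ (k + 1))) := by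
    refine hS.induction_on (p := fun T => ∃ θ : ℕ → ℝ, ∀ᶠ k in atTop, 0 ≤ θ k ∧ θ (k + 1) ≤ θ k ∧
      (w (k + 1) ∈ T → c * a (k + 1) ^ 2 ≤ M * a k * (θ k - θ (k + 1)))) ?_ ?_ ?_ ?_
    · exact ⟨fun _ => 0, by simp⟩
    · rintro s t hst ⟨θ, hθ⟩
      exact ⟨θ, hθ.mono fun k hk => ⟨hk.1, hk.2.1, fun h => hk.2.2 (hst h)⟩⟩
    · rintro s t ⟨θ, hθ⟩ ⟨θ', hθ'⟩
      refine ⟨fun k => θ k + θ' k, ?_⟩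
      filter_upwards [hθ, hθ'] with k h1 h2
      have h3 : 0 ≤ M * a k := mul_nonneg hM (ha k)
      have h4 := mul_nonneg h3 (sub_nonneg.2 h1.2.1)
      have h5 := mul_nonneg h3 (sub_nonneg.2 h2.2.1)
      refine ⟨add_nonneg h1.1 h2.1, add_le_add h1.2.1 h2.2.1, ?_⟩
      rintro (h | h)
      · linarith [h1.2.2 h]
      · linarith [h2.2.2 h]
    · intro x hx
      by_cases hcl : MapClusterPt x atTop w
      · obtain ⟨σ, hσ, hσx⟩ := hcl.tendsto_subseq
        have hfσ : Tendsto (fun k => f (w (σ k))) atTop (𝓝 (f x)) :=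
          (hfS x hx).tendsto.comp
            (tendsto_nhdsWithin_iff.2 ⟨hσx, Eventually.of_forall fun k => hwS _⟩)
        have hfx : f x = (l : EReal) := by
          refine tendsto_nhds_unique hfσ ?_
          simp only [hf]
          exact (continuous_coe_real_ereal.tendsto l).comp (hl.comp hσ.tendsto_atTop)
        have h0 : (0 : W) ∈ subdiff f x :=
          ⟨by simp [hfx], by simp [hfx], w ∘ σ, v ∘ σ, fun k => hv _, hσx, hfσ,
            hv0.comp hσ.tendsto_atTop⟩
        obtain ⟨U, hU, θ, hθ⟩ :=
          (hKL x ⟨0, h0⟩).exists_decrement hc hM ha hf hfx hv hva hdec hl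
        exact ⟨U, mem_nhdsWithin_of_mem_nhds hU, θ, hθ⟩
      · rw [mapClusterPt_iff_frequently] at hcl
        push Not at hcl
        obtain ⟨U, hU, hev⟩ := hcl
        refine ⟨U, mem_nhdsWithin_of_mem_nhds hU, fun _ => 0, ?_⟩
        filter_upwards [(tendsto_add_atTop_nat 1).eventually hev] with k hk
        exact ⟨le_rfl, le_rfl, fun h => absurd h hk⟩
  obtain ⟨θ, hθ⟩ := hcover
  exact summable_of_sq_le_mul_sub hc hM ha
    (hθ.mono fun k hk => ⟨hk.1, hk.2.1, hk.2.2 (hwS _)⟩)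

end KL

/-! ### The sweep of the multi-block ADMM -/

theorem Fin.two_mul_sum_inner_sum_Ioi {F : Type*} [NormedAddCommGroup F] [InnerProductSpace ℝ F] :
    ∀ {m : ℕ} (d : Fin m → F), 2 * ∑ i, inner ℝ (∑ j ∈ Finset.Ioi i, d j) (d i)
      = ‖∑ i, d i‖ ^ 2 - ∑ i, ‖d i‖ ^ 2
  | 0, d => by simp
  | m + 1, d => by
    have ih := Fin.two_mul_sum_inner_sum_Ioi fun i : Fin m => d i.succ
    simp only [Fin.sum_univ_succ, Fin.sum_Ioi_zero, Fin.sum_Ioi_succ]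
    rw [norm_add_sq_real, real_inner_comm]
    linarith

theorem Fin.sum_Iio_add_add_sum_Ioi {M : Type*} [AddCommMonoid M] {m : ℕ} (d : Fin m → M)
    (i : Fin m) : ∑ j ∈ Finset.Iio i, d j + d i + ∑ j ∈ Finset.Ioi i, d j = ∑ j, d j := by
  rw [add_assoc, ← Finset.sum_cons (by simp : i ∉ Finset.Ioi i),
    ← Finset.sum_union (Finset.disjoint_left.2 fun j hj hj' => ?_)]
  · refine Finset.sum_congr ?_ fun _ _ => rfl
    ext j
    simp only [Finset.mem_union, Finset.mem_Iio, Finset.mem_cons, Finset.mem_Ioi,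
      Finset.mem_univ, iff_true]
    exact lt_trichotomy j i
  · simp only [Finset.mem_Iio, Finset.mem_cons, Finset.mem_Ioi] at hj hj'
    rcases hj' with rfl | hj'
    · exact lt_irrefl _ hj
    · exact lt_asymm hj hj'

namespace SharingProblem

variable {m p : ℕ} {n : Fin (m + 1) → ℕ} {P : SharingProblem m p n} {γ : ℝ} {L : ℝ≥0}
  {x : ℕ → (i : Fin (m + 1)) → EuclideanSpace ℝ (Fin (n i))}
  {y lam : ℕ → EuclideanSpace ℝ (Fin p)}

theorem Scenario2.gamma_pos (hS : P.Scenario2 γ L) : 0 < γ :=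
  lt_of_le_of_lt (by positivity) hS.gamma_gt

theorem Scenario2.lipschitz_lt_gamma (hS : P.Scenario2 γ L) : (L : ℝ) < γ := by
  have h : (1 : ℝ) ≤ Real.sqrt 2 := Real.one_le_sqrt.2 one_le_two
  exact lt_of_le_of_lt (le_mul_of_one_le_left L.2 h) hS.gamma_gt

theorem Scenario2.two_mul_sq_lt (hS : P.Scenario2 γ L) : 2 * (L : ℝ) ^ 2 < γ ^ 2 := by
  have h := pow_lt_pow_left₀ hS.gamma_gt (by positivity) two_ne_zero
  rwa [mul_pow, Real.sq_sqrt zero_le_two] at h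

theorem Scenario2.convexOn_X (hS : P.Scenario2 γ L) (i : Fin (m + 1)) :
    ConvexOn ℝ (P.X i) (P.f i) :=
  (hS.convex_f i).subset (Set.subset_univ _) (hS.convex_X i)

theorem Scenario2.continuous_f (hS : P.Scenario2 γ L) (i : Fin (m + 1)) : Continuous (P.f i) :=
  continuousOn_univ.1 ((hS.convex_f i).continuousOn isOpen_univ)

/-- The correction to the multiplier in the optimality condition of block `i`. It comes from the
blocks `i + 1, …, N`, which block `i` sees before their update. -/
def lag (P : SharingProblem m p n)
    (x : ℕ → (i : Fin (m + 1)) → EuclideanSpace ℝ (Fin (n i)))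
    (y : ℕ → EuclideanSpace ℝ (Fin p)) (k : ℕ) (i : Fin (m + 1)) : EuclideanSpace ℝ (Fin p) :=
  ∑ j ∈ Finset.Ioi i, (P.A j (x (k + 1) j) - P.A j (x k j)) + (y (k + 1) - y k)

theorem stepLength_nonneg (P : SharingProblem m p n)
    (x : ℕ → (i : Fin (m + 1)) → EuclideanSpace ℝ (Fin (n i)))
    (y lam : ℕ → EuclideanSpace ℝ (Fin p)) (k : ℕ) : 0 ≤ P.stepLength x y lam k := by
  unfold stepLength
  positivity

theorem norm_lag_add_le_stepLength (P : SharingProblem m p n)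
    (x : ℕ → (i : Fin (m + 1)) → EuclideanSpace ℝ (Fin (n i)))
    (y lam : ℕ → EuclideanSpace ℝ (Fin p)) (k : ℕ) (i : Fin (m + 1)) :
    ‖P.lag x y k i‖ + ‖lam k - lam (k + 1)‖ ≤ P.stepLength x y lam k := by
  unfold lag stepLength
  have h1 : ‖∑ j ∈ Finset.Ioi i, (P.A j (x (k + 1) j) - P.A j (x k j))‖
      ≤ ∑ j, ‖P.A j (x k j) - P.A j (x (k + 1) j)‖ := by
    refine (norm_sum_le _ _).trans ?_
    simp only [norm_sub_rev (P.A _ (x (k + 1) _))]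
    exact Finset.sum_le_sum_of_subset_of_nonneg (Finset.subset_univ _) fun _ _ _ => norm_nonneg _
  have h2 := norm_add_le (∑ j ∈ Finset.Ioi i, (P.A j (x (k + 1) j) - P.A j (x k j)))
    (y (k + 1) - y k)
  rw [norm_sub_rev (y (k + 1))] at h2
  linarith

/-- The optimality condition of the update of block `i`, written with the new multiplier. -/
theorem IsADMM.block_le (hS : P.Scenario2 γ L) (h : P.IsADMM γ x y lam) (k : ℕ)
    (i : Fin (m + 1)) {z : EuclideanSpace ℝ (Fin (n i))} (hz : z ∈ P.X i) :
    P.f i (x (k + 1) i) + inner ℝ (lam (k + 1) + γ • P.lag x y k i) (P.A i (z - x (k + 1) i))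
      ≤ P.f i z := by
  have hγ := hS.gamma_pos.ne'
  have hmin : IsMinOn (fun z => P.f i z + γ / 2 * ‖P.A i z +
      (∑ j ∈ Finset.Iio i, P.A j (x (k + 1) j) + ∑ j ∈ Finset.Ioi i, P.A j (x k j)
        + y k - P.b - (1 / γ) • lam k)‖ ^ 2) (P.X i) (x (k + 1) i) := by
    convert h.update_x k i using 6
    abel
  have key := (hS.convexOn_X i).add_inner_le_of_isMinOn_add_sq (h.mem k i) hmin hz
  convert key using 3
  rw [h.update_lam, residual, lag, ← Fin.sum_Iio_add_add_sum_Ioi _ i, Finset.sum_sub_distrib]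
  have : (γ * (1 / γ)) • lam k = lam k := by rw [mul_one_div_cancel hγ, one_smul]
  simp only [smul_add, smul_sub, smul_smul, this]
  abel

/-- The optimality condition of the update of the last block. -/
theorem IsADMM.last_le (hS : P.Scenario2 γ L) (h : P.IsADMM γ x y lam) (k : ℕ)
    (z : EuclideanSpace ℝ (Fin p)) :
    P.fN (y (k + 1)) + inner ℝ (lam (k + 1)) (z - y (k + 1)) ≤ P.fN z := by
  have hγ := hS.gamma_pos.ne'
  have hmin : IsMinOn (fun z => P.fN z + γ / 2 * ‖ContinuousLinearMap.id ℝ _ z +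
      (∑ j, P.A j (x (k + 1) j) - P.b - (1 / γ) • lam k)‖ ^ 2) Set.univ (y (k + 1)) := by
    convert h.update_y k using 6
    simp only [ContinuousLinearMap.id_apply]
    abel
  have key := hS.convex_fN.add_inner_le_of_isMinOn_add_sq (Set.mem_univ _) hmin (Set.mem_univ z)
  simp only [ContinuousLinearMap.id_apply] at key
  convert key using 3
  rw [h.update_lam, residual]
  have : (γ * (1 / γ)) • lam k = lam k := by rw [mul_one_div_cancel hγ, one_smul]
  simp only [smul_add, smul_sub, smul_smul, this]
  abel

theorem IsADMM.gradient_eq (hS : P.Scenario2 γ L) (h : P.IsADMM γ x y lam) (k : ℕ) :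
    gradient P.fN (y (k + 1)) = lam (k + 1) :=
  gradient_eq_of_forall_add_inner_le (hS.differentiable_fN _) (h.last_le hS k)

theorem IsADMM.norm_lam_sub_le (hS : P.Scenario2 γ L) (h : P.IsADMM γ x y lam) (k : ℕ) :
    ‖lam (k + 1) - lam (k + 2)‖ ≤ L * ‖y (k + 1) - y (k + 2)‖ := by
  rw [← h.gradient_eq hS k, ← h.gradient_eq hS (k + 1), ← dist_eq_norm, ← dist_eq_norm]
  exact hS.lipschitz_fN.dist_le_mul _ _

theorem IsADMM.smul_residual (h : P.IsADMM γ x y lam) (k : ℕ) :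
    γ • P.residual (x (k + 1)) (y (k + 1)) = lam k - lam (k + 1) := by
  rw [h.update_lam]; abel

/-! ### Descent of the augmented Lagrangian -/

/-- One sweep from a point of `Ω` decreases the augmented Lagrangian, up to the increase caused by
the multiplier update. -/
theorem IsADMM.augLagrangian_succ_le (hS : P.Scenario2 γ L) (h : P.IsADMM γ x y lam) (k : ℕ)
    (hx : ∀ i, x k i ∈ P.X i) :
    P.augLagrangian γ (x (k + 1)) (y (k + 1)) (lam (k + 1))
        + γ / 2 * ∑ i, ‖P.A i (x k i) - P.A i (x (k + 1) i)‖ ^ 2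
        + γ / 2 * ‖y k - y (k + 1)‖ ^ 2
      ≤ P.augLagrangian γ (x k) (y k) (lam k) + 1 / γ * ‖lam k - lam (k + 1)‖ ^ 2 := by
  have hγ := hS.gamma_pos
  obtain ⟨d, hd⟩ : ∃ d : Fin (m + 1) → EuclideanSpace ℝ (Fin p),
    ∀ i, d i = P.A i (x (k + 1) i) - P.A i (x k i) := ⟨_, fun _ => rfl⟩
  obtain ⟨e, he⟩ : ∃ e, e = y (k + 1) - y k := ⟨_, rfl⟩
  obtain ⟨l, hl⟩ : ∃ l, l = lam (k + 1) := ⟨_, rfl⟩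
  obtain ⟨r, hr⟩ : ∃ r, r = P.residual (x (k + 1)) (y (k + 1)) := ⟨_, rfl⟩
  have hlam : lam k = l + γ • r := by rw [hl, hr, h.update_lam]; abel
  have hres : P.residual (x k) (y k) = r - (∑ i, d i + e) := by
    simp only [hr, residual, hd, he, Finset.sum_sub_distrib]; abel
  have hb : ∑ i, P.f i (x (k + 1) i) - inner ℝ l (∑ i, d i)
      - γ * ∑ i, inner ℝ (∑ j ∈ Finset.Ioi i, d j) (d i) - γ * inner ℝ e (∑ i, d i)
      ≤ ∑ i, P.f i (x k i) := by
    rw [inner_sum, inner_sum, Finset.mul_sum, Finset.mul_sum, ← Finset.sum_sub_distrib,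
      ← Finset.sum_sub_distrib, ← Finset.sum_sub_distrib]
    refine Finset.sum_le_sum fun i _ => ?_
    have := h.block_le hS k i (hx i)
    have h2 : P.A i (x k i - x (k + 1) i) = -d i := by rw [map_sub, hd, neg_sub]
    simp only [h2, lag, ← hd, ← he, ← hl] at this
    rw [inner_neg_right, inner_add_left, real_inner_smul_left, inner_add_left] at this
    linarith
  have hl2 := h.last_le hS k (y k)
  have hye : y k - y (k + 1) = -e := by rw [he, neg_sub]
  rw [hye, inner_neg_right, ← hl] at hl2
  have hdd : γ * ∑ i, inner ℝ (∑ j ∈ Finset.Ioi i, d j) (d i)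
      = γ / 2 * ‖∑ i, d i‖ ^ 2 - γ / 2 * ∑ i, ‖d i‖ ^ 2 := by
    rw [← mul_sub, ← Fin.two_mul_sum_inner_sum_Ioi d]
    ring
  have hn : 1 / γ * ‖lam k - l‖ ^ 2 = γ * ‖r‖ ^ 2 := by
    rw [hlam, add_sub_cancel_left, norm_smul, Real.norm_eq_abs, mul_pow, sq_abs]
    field_simp
  rw [← hl, hn, hye, norm_neg]
  simp only [norm_sub_rev (P.A _ (x k _)), ← hd]
  rw [augLagrangian, augLagrangian, hres, ← hr, hlam, objective, objective, norm_sub_sq_real,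
    norm_add_sq_real, inner_add_left, real_inner_smul_left, inner_sub_right, inner_sub_right,
    inner_add_right, inner_add_right, real_inner_self_eq_norm_sq, real_inner_comm e (∑ i, d i)]
  linarith

/-- The augmented Lagrangian at an iterate dominates the objective with the last variable moved
to satisfy the coupling constraint. -/
theorem IsADMM.le_augLagrangian (hS : P.Scenario2 γ L) (h : P.IsADMM γ x y lam) (k : ℕ) :
    ∑ i, P.f i (x (k + 1) i)
        + P.fN (y (k + 1) - P.residual (x (k + 1)) (y (k + 1)))
        + (γ - L) / 2 * ‖P.residual (x (k + 1)) (y (k + 1))‖ ^ 2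
      ≤ P.augLagrangian γ (x (k + 1)) (y (k + 1)) (lam (k + 1)) := by
  have := le_add_inner_gradient_add_sq hS.differentiable_fN hS.lipschitz_fN (y (k + 1))
    (-P.residual (x (k + 1)) (y (k + 1)))
  rw [h.gradient_eq hS, inner_neg_right, norm_neg, ← sub_eq_add_neg] at this
  rw [augLagrangian, objective]
  linarith

theorem sq_sum_add_add_le {α : Fin (m + 1) → ℝ} {β τ K : ℝ} (hα : ∀ i, 0 ≤ α i) (hβ : 0 ≤ β)
    (hτ : 0 ≤ τ) (hK : 0 ≤ K) (hτβ : τ ≤ K * β) :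
    (∑ i, α i + β + τ) ^ 2 ≤ 2 * (m + 1) * (1 + K) ^ 2 * (∑ i, α i ^ 2 + β ^ 2) := by
  have hα1 : 0 ≤ ∑ i, α i := Finset.sum_nonneg fun i _ => hα i
  have hα2 : 0 ≤ ∑ i, α i ^ 2 := Finset.sum_nonneg fun _ _ => sq_nonneg _
  have hcs : (∑ i, α i) ^ 2 ≤ (m + 1) * ∑ i, α i ^ 2 := by
    have := sq_sum_le_card_mul_sum_sq (s := Finset.univ) (f := α)
    simpa using this
  have h2 : (∑ i, α i + β + τ) ^ 2 ≤ (∑ i, α i + (1 + K) * β) ^ 2 :=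
    pow_le_pow_left₀ (by positivity) (by linarith) 2
  have h3 := add_sq_le (a := ∑ i, α i) (b := (1 + K) * β)
  have h4 : (∑ i, α i) ^ 2 ≤ (1 + K) ^ 2 * ((m + 1) * ∑ i, α i ^ 2) :=
    hcs.trans (le_mul_of_one_le_left (by positivity) (one_le_pow₀ (by linarith)))
  have h5 : ((1 + K) * β) ^ 2 ≤ (m + 1) * ((1 + K) * β) ^ 2 :=
    le_mul_of_one_le_left (by positivity) (by linarith [(Nat.cast_nonneg m : (0 : ℝ) ≤ m)])
  calc (∑ i, α i + β + τ) ^ 2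
      ≤ 2 * ((1 + K) ^ 2 * ((m + 1) * ∑ i, α i ^ 2) + (m + 1) * ((1 + K) * β) ^ 2) := by linarith
    _ = _ := by ring

/-- Sufficient decrease of the augmented Lagrangian along the iterates. The multiplier update
costs at most `(L² / γ) ‖y k - y (k + 1)‖²`, which is less than the gain `(γ / 2) ‖y k - y (k + 1)‖²`
of the last block because `γ > √2 L`. -/
theorem IsADMM.exists_sufficient_decrease (hS : P.Scenario2 γ L) (h : P.IsADMM γ x y lam) :
    ∃ c : ℝ, 0 < c ∧ ∀ k, P.augLagrangian γ (x (k + 2)) (y (k + 2)) (lam (k + 2))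
        + c * P.stepLength x y lam (k + 1) ^ 2
      ≤ P.augLagrangian γ (x (k + 1)) (y (k + 1)) (lam (k + 1)) := by
  have hγ := hS.gamma_pos
  have hL : (0 : ℝ) ≤ L := L.coe_nonneg
  obtain ⟨κ, hκ⟩ : ∃ κ : ℝ, κ = γ / 2 - L ^ 2 / γ := ⟨_, rfl⟩
  have hκ0 : 0 < κ := by
    rw [hκ, sub_pos, div_lt_div_iff₀ hγ two_pos]
    nlinarith [hS.two_mul_sq_lt]
  have hκγ : κ ≤ γ / 2 := by
    have : 0 ≤ (L : ℝ) ^ 2 / γ := by positivity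
    linarith
  refine ⟨κ / (2 * (m + 1) * (1 + L) ^ 2), by positivity, fun k => ?_⟩
  have hdec := h.augLagrangian_succ_le hS (k + 1) (h.mem k)
  have hlam := h.norm_lam_sub_le hS k
  have hsq := sq_sum_add_add_le (α := fun i => ‖P.A i (x (k + 1) i) - P.A i (x (k + 2) i)‖)
    (fun _ => norm_nonneg _) (norm_nonneg _) (norm_nonneg _) hL hlam
  have hα2 : 0 ≤ ∑ i, ‖P.A i (x (k + 1) i) - P.A i (x (k + 2) i)‖ ^ 2 :=
    Finset.sum_nonneg fun _ _ => sq_nonneg _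
  have hc : κ / (2 * (m + 1) * (1 + L) ^ 2) * P.stepLength x y lam (k + 1) ^ 2
      ≤ κ * (∑ i, ‖P.A i (x (k + 1) i) - P.A i (x (k + 2) i)‖ ^ 2
        + ‖y (k + 1) - y (k + 2)‖ ^ 2) := by
    rw [div_mul_eq_mul_div, div_le_iff₀ (by positivity), mul_assoc]
    refine mul_le_mul_of_nonneg_left (hsq.trans_eq ?_) hκ0.le
    ring
  have hτ : 1 / γ * ‖lam (k + 1) - lam (k + 2)‖ ^ 2
      ≤ L ^ 2 / γ * ‖y (k + 1) - y (k + 2)‖ ^ 2 := by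
    have := pow_le_pow_left₀ (norm_nonneg _) hlam 2
    rw [mul_pow] at this
    rw [div_mul_eq_mul_div, div_mul_eq_mul_div, one_mul]
    exact div_le_div_of_nonneg_right this hγ.le
  have h6 := mul_le_mul_of_nonneg_right hκγ hα2
  have h7 : κ * ‖y (k + 1) - y (k + 2)‖ ^ 2 = γ / 2 * ‖y (k + 1) - y (k + 2)‖ ^ 2
      - L ^ 2 / γ * ‖y (k + 1) - y (k + 2)‖ ^ 2 := by rw [hκ]; ring
  rw [show k + 1 + 1 = k + 2 from rfl] at hdec
  linarith

theorem IsADMM.augLagrangian_le_one (hS : P.Scenario2 γ L) (h : P.IsADMM γ x y lam) (k : ℕ) :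
    P.augLagrangian γ (x (k + 1)) (y (k + 1)) (lam (k + 1))
      ≤ P.augLagrangian γ (x 1) (y 1) (lam 1) := by
  obtain ⟨c, hc, hdec⟩ := h.exists_sufficient_decrease hS
  induction k with
  | zero => exact le_rfl
  | succ k ih =>
    have := hdec k
    have : 0 ≤ c * P.stepLength x y lam (k + 1) ^ 2 := by positivity
    linarith

theorem IsADMM.bddBelow_augLagrangian (hS : P.Scenario2 γ L) (h : P.IsADMM γ x y lam) :
    BddBelow (Set.range fun k => P.augLagrangian γ (x (k + 1)) (y (k + 1)) (lam (k + 1))) := by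
  choose c hc using hS.bddBelow_f
  obtain ⟨cN, hcN⟩ := hS.bddBelow_fN
  refine ⟨∑ i, c i + cN, ?_⟩
  rintro _ ⟨k, rfl⟩
  have h1 := h.le_augLagrangian hS k
  have h2 : ∑ i, c i ≤ ∑ i, P.f i (x (k + 1) i) :=
    Finset.sum_le_sum fun i _ => hc i (Set.mem_image_of_mem _ (h.mem k i))
  have h3 := hcN (Set.mem_range_self (y (k + 1) - P.residual (x (k + 1)) (y (k + 1))))
  have h4 := sub_pos.2 hS.lipschitz_lt_gamma
  have h5 : 0 ≤ (γ - L) / 2 * ‖P.residual (x (k + 1)) (y (k + 1))‖ ^ 2 := by positivity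
  dsimp only
  linarith

/-- Coercivity of the objective and the decrease of the augmented Lagrangian bound the iterates. -/
theorem IsADMM.exists_norm_le (hS : P.Scenario2 γ L) (h : P.IsADMM γ x y lam) :
    ∃ R : ℝ, ∀ k, (∀ i, ‖x (k + 1) i‖ ≤ R) ∧ ‖y (k + 1)‖ ≤ R ∧ ‖lam (k + 1)‖ ≤ R := by
  choose c hc using hS.bddBelow_f
  obtain ⟨cN, hcN⟩ := hS.bddBelow_fN
  set F := P.augLagrangian γ (x 1) (y 1) (lam 1) with hF
  have hδ := sub_pos.2 hS.lipschitz_lt_gamma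
  have hfc : ∀ k i, c i ≤ P.f i (x (k + 1) i) := fun k i =>
    hc i (Set.mem_image_of_mem _ (h.mem k i))
  have hub : ∀ k, ∑ i, (P.f i (x (k + 1) i) - c i)
      + (γ - L) / 2 * ‖P.residual (x (k + 1)) (y (k + 1))‖ ^ 2 ≤ F - cN - ∑ i, c i := by
    intro k
    have h1 := h.le_augLagrangian hS k
    have h3 := hcN (Set.mem_range_self (y (k + 1) - P.residual (x (k + 1)) (y (k + 1))))
    have h4 := h.augLagrangian_le_one hS k
    rw [Finset.sum_sub_distrib]
    linarith
  have hx : ∀ i, ∃ R : ℝ, ∀ k, ‖x (k + 1) i‖ ≤ R := by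
    intro i
    set K := F - cN - ∑ i, c i + c i
    have h1 := (hS.coercive_f i).eventually_gt_atTop K
    rw [eventually_inf_principal] at h1
    have h2 : Bornology.IsBounded {z | z ∈ P.X i → K < P.f i z}ᶜ := by
      rw [Bornology.isBounded_def, compl_compl]
      exact h1
    obtain ⟨R, hR⟩ := h2.exists_norm_le
    refine ⟨R, fun k => hR _ ?_⟩
    simp only [Set.mem_compl_iff, Set.mem_ofPred_eq, not_forall, not_lt]
    refine ⟨h.mem k i, ?_⟩
    have h3 := Finset.single_le_sum (f := fun i => P.f i (x (k + 1) i) - c i)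
      (fun j _ => sub_nonneg.2 (hfc k j)) (Finset.mem_univ i)
    have h4 := hub k
    have h5 : 0 ≤ (γ - L) / 2 * ‖P.residual (x (k + 1)) (y (k + 1))‖ ^ 2 := by positivity
    linarith
  choose Rx hRx using hx
  set ρ := Real.sqrt ((F - cN - ∑ i, c i) / ((γ - L) / 2)) with hρ
  have hr : ∀ k, ‖P.residual (x (k + 1)) (y (k + 1))‖ ≤ ρ := by
    intro k
    refine Real.le_sqrt_of_sq_le ?_
    rw [le_div_iff₀ (by positivity)]
    have h1 : 0 ≤ ∑ i, (P.f i (x (k + 1) i) - c i) :=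
      Finset.sum_nonneg fun j _ => sub_nonneg.2 (hfc k j)
    linarith [hub k]
  set Ry := ρ + ‖P.b‖ + ∑ i, ‖P.A i‖ * Rx i with hRy
  have hy : ∀ k, ‖y (k + 1)‖ ≤ Ry := by
    intro k
    have h1 : y (k + 1) = P.residual (x (k + 1)) (y (k + 1)) + P.b
        - ∑ i, P.A i (x (k + 1) i) := by
      rw [residual]; abel
    have h2 : ‖∑ i, P.A i (x (k + 1) i)‖ ≤ ∑ i, ‖P.A i‖ * Rx i :=
      norm_sum_le_of_le _ fun i _ => (P.A i).le_opNorm_of_le (hRx i k)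
    rw [h1]
    refine (norm_sub_le _ _).trans (add_le_add ((norm_add_le _ _).trans ?_) h2)
    gcongr
    exact hr k
  have hl : ∀ k, ‖lam (k + 1)‖ ≤ ‖gradient P.fN 0‖ + L * Ry := by
    intro k
    have h1 := hS.lipschitz_fN.dist_le_mul (y (k + 1)) 0
    rw [dist_eq_norm, dist_zero_right, h.gradient_eq hS] at h1
    have h2 := norm_sub_norm_le (lam (k + 1)) (gradient P.fN 0)
    have h3 := mul_le_mul_of_nonneg_left (hy k) L.coe_nonneg
    linarith
  have hRx0 : ∀ i, 0 ≤ Rx i := fun i => (norm_nonneg _).trans (hRx i 0)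
  have hRy0 : 0 ≤ Ry := (norm_nonneg _).trans (hy 0)
  have hRl0 : 0 ≤ ‖gradient P.fN 0‖ + L * Ry := (norm_nonneg _).trans (hl 0)
  refine ⟨∑ i, Rx i + Ry + (‖gradient P.fN 0‖ + L * Ry), fun k => ⟨fun i => ?_, ?_, ?_⟩⟩
  · have := Finset.single_le_sum (fun j _ => hRx0 j) (Finset.mem_univ i)
    linarith [hRx i k]
  · have := Finset.sum_nonneg fun i (_ : i ∈ Finset.univ) => hRx0 i
    linarith [hy k]
  · have := Finset.sum_nonneg fun i (_ : i ∈ Finset.univ) => hRx0 i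
    linarith [hl k]

/-! ### Finite length of the trajectory -/

/-- The Euclidean space `ℝ^{n_1} × ⋯ × ℝ^{n_{N-1}} × ℝ^p × ℝ^p` of the variables
`(x_1, …, x_N, λ)`. -/
abbrev PrimalDual (p : ℕ) (n : Fin (m + 1) → ℕ) : Type :=
  WithLp 2 (PiLp 2 (fun i : Fin (m + 1) => EuclideanSpace ℝ (Fin (n i))) ×
    WithLp 2 (EuclideanSpace ℝ (Fin p) × EuclideanSpace ℝ (Fin p)))

/-- The point `(x_1, …, x_{N-1}, y, λ)` of the space of primal-dual variables. -/
def primalDual (x : (i : Fin (m + 1)) → EuclideanSpace ℝ (Fin (n i)))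
    (y lam : EuclideanSpace ℝ (Fin p)) : PrimalDual p n :=
  WithLp.toLp 2 (WithLp.toLp 2 x, WithLp.toLp 2 (y, lam))

theorem inner_primalDual (x : (i : Fin (m + 1)) → EuclideanSpace ℝ (Fin (n i)))
    (y lam : EuclideanSpace ℝ (Fin p)) (w : PrimalDual p n) :
    inner ℝ (primalDual x y lam) w
      = ∑ i, inner ℝ (x i) (w.fst i) + (inner ℝ y w.snd.fst + inner ℝ lam w.snd.snd) := by
  rw [WithLp.prod_inner_apply, PiLp.inner_apply]
  congr 1

theorem norm_sq_eq_sum (w : PrimalDual p n) :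
    ‖w‖ ^ 2 = ∑ i, ‖w.fst i‖ ^ 2 + (‖w.snd.fst‖ ^ 2 + ‖w.snd.snd‖ ^ 2) := by
  rw [WithLp.prod_norm_sq_eq_of_L2, PiLp.norm_sq_eq_of_L2, WithLp.prod_norm_sq_eq_of_L2]

theorem norm_primalDual_le (x : (i : Fin (m + 1)) → EuclideanSpace ℝ (Fin (n i)))
    (y lam : EuclideanSpace ℝ (Fin p)) :
    ‖primalDual x y lam‖ ≤ ∑ i, ‖x i‖ + ‖y‖ + ‖lam‖ := by
  have h0 : 0 ≤ ∑ i, ‖x i‖ := Finset.sum_nonneg fun _ _ => norm_nonneg _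
  refine le_of_sq_le_sq ?_ (by positivity)
  have h1 : ‖primalDual x y lam‖ ^ 2 = ∑ i, ‖x i‖ ^ 2 + (‖y‖ ^ 2 + ‖lam‖ ^ 2) :=
    norm_sq_eq_sum _
  have h2 : ∑ i, ‖x i‖ ^ 2 ≤ (∑ i, ‖x i‖) ^ 2 :=
    Finset.sum_sq_le_sq_sum_of_nonneg fun _ _ => norm_nonneg _
  have h3 := mul_nonneg h0 (norm_nonneg y)
  have h4 := mul_nonneg h0 (norm_nonneg lam)
  have h5 := mul_nonneg (norm_nonneg y) (norm_nonneg lam)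
  nlinarith

theorem norm_fst_apply_le (w : PrimalDual p n) (i : Fin (m + 1)) : ‖w.fst i‖ ≤ ‖w‖ := by
  refine le_of_sq_le_sq ?_ (norm_nonneg _)
  rw [norm_sq_eq_sum]
  have := Finset.single_le_sum (f := fun i => ‖w.fst i‖ ^ 2) (fun j _ => sq_nonneg _)
    (Finset.mem_univ i)
  nlinarith [sq_nonneg ‖w.snd.fst‖, sq_nonneg ‖w.snd.snd‖]

theorem norm_snd_fst_le (w : PrimalDual p n) : ‖w.snd.fst‖ ≤ ‖w‖ := by
  refine le_of_sq_le_sq ?_ (norm_nonneg _)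
  rw [norm_sq_eq_sum]
  have : 0 ≤ ∑ i, ‖w.fst i‖ ^ 2 := Finset.sum_nonneg fun _ _ => sq_nonneg _
  nlinarith [sq_nonneg ‖w.snd.snd‖]

theorem norm_snd_snd_le (w : PrimalDual p n) : ‖w.snd.snd‖ ≤ ‖w‖ := by
  refine le_of_sq_le_sq ?_ (norm_nonneg _)
  rw [norm_sq_eq_sum]
  have : 0 ≤ ∑ i, ‖w.fst i‖ ^ 2 := Finset.sum_nonneg fun _ _ => sq_nonneg _
  nlinarith [sq_nonneg ‖w.snd.fst‖]

theorem extLagrangian_of_mem {w : PrimalDual p n} (hw : ∀ i, w.fst i ∈ P.X i) :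
    P.extLagrangian γ w
      = (P.augLagrangian γ (fun i => w.fst i) w.snd.fst w.snd.snd : ℝ) :=
  if_pos hw

/-- A Fréchet subgradient of the extended augmented Lagrangian at the `(k + 1)`-st iterate. -/
def subgrad (P : SharingProblem m p n) (γ : ℝ)
    (x : ℕ → (i : Fin (m + 1)) → EuclideanSpace ℝ (Fin (n i)))
    (y : ℕ → EuclideanSpace ℝ (Fin p)) (k : ℕ) : PrimalDual p n :=
  primalDual
    (fun i => ContinuousLinearMap.adjoint (P.A i)
      (γ • P.lag x y k i + γ • P.residual (x (k + 1)) (y (k + 1))))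
    (γ • P.residual (x (k + 1)) (y (k + 1)))
    (-P.residual (x (k + 1)) (y (k + 1)))

/-- Only the term `⟨λ, ∑ A_i x_i - b⟩` of the augmented Lagrangian is not convex, and its deviation
from its linearization is bounded by a multiple of the squared distance. -/
theorem IsADMM.subgrad_mem (hS : P.Scenario2 γ L) (h : P.IsADMM γ x y lam) (k : ℕ) :
    P.subgrad γ x y k ∈ KL.frechetSubdiff (P.extLagrangian γ)
      (primalDual (x (k + 1)) (y (k + 1)) (lam (k + 1))) := by
  have hγ := hS.gamma_pos
  have hA : 0 ≤ ∑ i, ‖P.A i‖ := Finset.sum_nonneg fun _ _ => norm_nonneg _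
  refine KL.mem_frechetSubdiff_of_sq (K := ∑ i, ‖P.A i‖ + 1)
    (extLagrangian_of_mem (h.mem k)) (by positivity) fun w => ?_
  by_cases hw : ∀ i, w.fst i ∈ P.X i
  swap
  · exact le_of_le_of_eq le_top (if_neg hw).symm
  rw [extLagrangian_of_mem hw, EReal.coe_le_coe_iff, subgrad, inner_primalDual]
  set u := w - primalDual (x (k + 1)) (y (k + 1)) (lam (k + 1)) with hu
  have hux : ∀ i, u.fst i = w.fst i - x (k + 1) i := fun i => rfl
  have huy : u.snd.fst = w.snd.fst - y (k + 1) := rfl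
  have hul : u.snd.snd = w.snd.snd - lam (k + 1) := rfl
  change P.augLagrangian γ (x (k + 1)) (y (k + 1)) (lam (k + 1)) + _ - _ ≤ _
  clear_value u
  obtain ⟨l, hl⟩ : ∃ l, l = lam (k + 1) := ⟨_, rfl⟩
  obtain ⟨r, hr⟩ : ∃ r, r = P.residual (x (k + 1)) (y (k + 1)) := ⟨_, rfl⟩
  obtain ⟨s, hs⟩ : ∃ s, s = ∑ i, P.A i (u.fst i) + u.snd.fst := ⟨_, rfl⟩
  have hres : P.residual (fun i => w.fst i) w.snd.fst = r + s := by
    simp only [hr, hs, residual, hux, huy, map_sub, Finset.sum_sub_distrib]; abel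
  have hsn : ‖s‖ ≤ (∑ i, ‖P.A i‖ + 1) * ‖u‖ := by
    rw [hs, add_mul, one_mul, Finset.sum_mul]
    exact (norm_add_le _ _).trans (add_le_add (norm_sum_le_of_le _ fun i _ =>
      (P.A i).le_opNorm_of_le (norm_fst_apply_le u i)) (norm_snd_fst_le u))
  have hbil : |inner ℝ u.snd.snd s| ≤ (∑ i, ‖P.A i‖ + 1) * ‖u‖ ^ 2 := by
    refine (abs_real_inner_le_norm _ _).trans ?_
    have := mul_le_mul (norm_snd_snd_le u) hsn (norm_nonneg _) (norm_nonneg _)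
    linarith
  have hb : ∑ i, P.f i (x (k + 1) i) + inner ℝ l (∑ i, P.A i (u.fst i))
      + ∑ i, inner ℝ (γ • P.lag x y k i) (P.A i (u.fst i)) ≤ ∑ i, P.f i (w.fst i) := by
    rw [inner_sum, ← Finset.sum_add_distrib, ← Finset.sum_add_distrib]
    refine Finset.sum_le_sum fun i _ => ?_
    have := h.block_le hS k i (hw i)
    rwa [← hux, ← hl, inner_add_left, ← add_assoc] at this
  have hN := h.last_le hS k w.snd.fst
  rw [← huy, ← hl] at hN
  have hsum : ∑ i, inner ℝ (ContinuousLinearMap.adjoint (P.A i) (γ • P.lag x y k i + γ • r))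
      (u.fst i) = ∑ i, inner ℝ (γ • P.lag x y k i) (P.A i (u.fst i))
        + γ * inner ℝ r (∑ i, P.A i (u.fst i)) := by
    rw [inner_sum, Finset.mul_sum, ← Finset.sum_add_distrib]
    refine Finset.sum_congr rfl fun i _ => ?_
    rw [ContinuousLinearMap.adjoint_inner_left, inner_add_left,
      real_inner_smul_left r]
  have hrs : inner ℝ r s = inner ℝ r (∑ i, P.A i (u.fst i)) + inner ℝ r u.snd.fst := by
    rw [hs, inner_add_right]
  have hls : inner ℝ l s = inner ℝ l (∑ i, P.A i (u.fst i)) + inner ℝ l u.snd.fst := by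
    rw [hs, inner_add_right]
  have hlw : w.snd.snd = l + u.snd.snd := by rw [hul, hl]; abel
  have hur := real_inner_comm r u.snd.snd
  have h0 : 0 ≤ γ / 2 * ‖s‖ ^ 2 := by positivity
  rw [← hr, hsum, augLagrangian, augLagrangian, objective, objective, hres, hlw, ← hr, ← hl,
    norm_add_sq_real, real_inner_smul_left, inner_neg_left, inner_add_left, inner_add_right,
    inner_add_right]
  have := (abs_le.1 hbil).2
  have hγrs : γ * inner ℝ r s
      = γ * inner ℝ r (∑ i, P.A i (u.fst i)) + γ * inner ℝ r u.snd.fst := by rw [hrs]; ring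
  linarith

/-- The relative error bound of the KL argument. -/
theorem IsADMM.norm_subgrad_le (hS : P.Scenario2 γ L) (h : P.IsADMM γ x y lam) (k : ℕ) :
    ‖P.subgrad γ x y k‖
      ≤ ((∑ i, ‖P.A i‖) * (γ + 1) + 1 + 1 / γ) * P.stepLength x y lam k := by
  have hγ := hS.gamma_pos
  have ha := stepLength_nonneg P x y lam k
  have hlag := norm_lag_add_le_stepLength P x y lam k
  have hlam : ‖lam k - lam (k + 1)‖ ≤ P.stepLength x y lam k := by
    linarith [hlag 0, norm_nonneg (P.lag x y k 0)]
  have hr : ‖P.residual (x (k + 1)) (y (k + 1))‖ = 1 / γ * ‖lam k - lam (k + 1)‖ := by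
    rw [← h.smul_residual, norm_smul, Real.norm_of_nonneg hγ.le]
    field_simp
  have hx : ∀ i, ‖ContinuousLinearMap.adjoint (P.A i)
      (γ • P.lag x y k i + γ • P.residual (x (k + 1)) (y (k + 1)))‖
      ≤ ‖P.A i‖ * ((γ + 1) * P.stepLength x y lam k) := by
    intro i
    rw [h.smul_residual]
    have h1 := (ContinuousLinearMap.adjoint (P.A i)).le_opNorm
      (γ • P.lag x y k i + (lam k - lam (k + 1)))
    rw [LinearIsometryEquiv.norm_map] at h1
    refine h1.trans (mul_le_mul_of_nonneg_left ?_ (norm_nonneg _))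
    refine (norm_add_le _ _).trans ?_
    rw [norm_smul, Real.norm_of_nonneg hγ.le]
    have h2 : γ * ‖P.lag x y k i‖ ≤ γ * P.stepLength x y lam k := by
      gcongr
      linarith [hlag i, norm_nonneg (lam k - lam (k + 1))]
    linarith
  refine (norm_primalDual_le _ _ _).trans ?_
  have h1 := Finset.sum_le_sum fun i (_ : i ∈ Finset.univ) => hx i
  rw [← Finset.sum_mul] at h1
  rw [norm_neg, hr, h.smul_residual]
  rw [h.smul_residual] at h1
  have h2 : 1 / γ * ‖lam k - lam (k + 1)‖ ≤ 1 / γ * P.stepLength x y lam k := by gcongr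
  linarith

theorem Scenario2.continuousOn_extLagrangian (hS : P.Scenario2 γ L) :
    ContinuousOn (P.extLagrangian γ) {w : PrimalDual p n | ∀ i, w.fst i ∈ P.X i} := by
  have hf := hS.continuous_f
  have hfN := hS.differentiable_fN.continuous
  have hc : Continuous fun w : PrimalDual p n =>
      P.augLagrangian γ (fun i => w.fst i) w.snd.fst w.snd.snd := by
    unfold augLagrangian objective residual
    fun_prop
  exact (continuous_coe_real_ereal.comp hc).continuousOn.congr fun w hw => extLagrangian_of_mem hw

/-- The trajectory has finite length: the sufficient decrease and the relative error bound hold for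
the steps measured through the `A i`, so the `A i` need not be injective. -/
theorem IsADMM.summable_stepLength (hS : P.Scenario2 γ L) (h : P.IsADMM γ x y lam) :
    Summable (P.stepLength x y lam) := by
  have hγ := hS.gamma_pos
  obtain ⟨c, hc, hdec⟩ := h.exists_sufficient_decrease hS
  obtain ⟨R, hR⟩ := h.exists_norm_le hS
  have hclosed : IsClosed {w : PrimalDual p n | ∀ i, w.fst i ∈ P.X i} := by
    simp only [Set.ofPred_forall]
    refine isClosed_iInter fun i => (hS.closed_X i).preimage ?_
    fun_prop
  have hcompact := (isCompact_closedBall (0 : PrimalDual p n)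
    (∑ _i : Fin (m + 1), R + R + R)).inter_left hclosed
  have hA : 0 ≤ ∑ i, ‖P.A i‖ := Finset.sum_nonneg fun _ _ => norm_nonneg _
  -- The starting point need not lie in `Ω`, so the descent argument starts at the first iterate.
  rw [← summable_nat_add_iff 1]
  refine hS.isKL.summable_steps (w := fun k => primalDual (x (k + 1)) (y (k + 1)) (lam (k + 1)))
    (v := P.subgrad γ x y) (M := (∑ i, ‖P.A i‖) * (γ + 1) + 1 + 1 / γ) hcompact
    (hS.continuousOn_extLagrangian.mono Set.inter_subset_left) (fun k => ⟨h.mem k, ?_⟩) hc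
    (by positivity) (fun k => stepLength_nonneg P x y lam _)
    (fun k => extLagrangian_of_mem (h.mem k)) (h.subgrad_mem hS)
    (fun k => h.norm_subgrad_le hS (k + 1)) hdec (h.bddBelow_augLagrangian hS)
  rw [mem_closedBall_zero_iff]
  refine (norm_primalDual_le _ _ _).trans ?_
  exact add_le_add (add_le_add (Finset.sum_le_sum fun i _ => (hR k).1 i) (hR k).2.1) (hR k).2.2

/-! ### The ergodic rate -/

theorem ergodicAvg_apply (z : ℕ → (i : Fin (m + 1)) → EuclideanSpace ℝ (Fin (n i))) (t : ℕ)
    (i : Fin (m + 1)) : ergodicAvg z t i = ergodicAvg (fun k => z k i) t := by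
  simp [ergodicAvg]

theorem map_ergodicAvg {E F : Type*} [AddCommGroup E] [Module ℝ E] [AddCommGroup F] [Module ℝ F]
    (A : E →ₗ[ℝ] F) (z : ℕ → E) (t : ℕ) :
    A (ergodicAvg z t) = ergodicAvg (fun k => A (z k)) t := by
  simp [ergodicAvg]

theorem ergodicAvg_mem {E : Type*} [AddCommGroup E] [Module ℝ E] {X : Set E} (hX : Convex ℝ X)
    {z : ℕ → E} (hz : ∀ k, z (k + 1) ∈ X) (t : ℕ) : ergodicAvg z t ∈ X := by
  rw [ergodicAvg, Finset.smul_sum]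
  refine hX.sum_mem (fun _ _ => by positivity) ?_ fun k _ => hz k
  simp only [Finset.sum_const, Finset.card_range, nsmul_eq_mul, Nat.cast_add, Nat.cast_one]
  field_simp

theorem map_ergodicAvg_le {E : Type*} [AddCommGroup E] [Module ℝ E] {X : Set E} {f : E → ℝ}
    (hf : ConvexOn ℝ X f) {z : ℕ → E} (hz : ∀ k, z (k + 1) ∈ X) (t : ℕ) :
    f (ergodicAvg z t) ≤ ergodicAvg (fun k => f (z k)) t := by
  rw [ergodicAvg, ergodicAvg, Finset.smul_sum, Finset.smul_sum]
  refine hf.map_sum_le (fun _ _ => by positivity) ?_ fun k _ => hz k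
  simp only [Finset.sum_const, Finset.card_range, nsmul_eq_mul, Nat.cast_add, Nat.cast_one]
  field_simp

theorem residual_ergodicAvg (P : SharingProblem m p n)
    (x : ℕ → (i : Fin (m + 1)) → EuclideanSpace ℝ (Fin (n i)))
    (y : ℕ → EuclideanSpace ℝ (Fin p)) (t : ℕ) :
    P.residual (ergodicAvg x t) (ergodicAvg y t)
      = ergodicAvg (fun k => P.residual (x k) (y k)) t := by
  have ht : (1 / ((t : ℝ) + 1)) • ∑ _k ∈ Finset.range (t + 1), P.b = P.b := by
    rw [Finset.sum_const, Finset.card_range, ← Nat.cast_smul_eq_nsmul ℝ, smul_smul]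
    have : 1 / ((t : ℝ) + 1) * ((t + 1 : ℕ) : ℝ) = 1 := by
      push_cast
      field_simp
    rw [this, one_smul]
  have hA : ∀ i, P.A i (ergodicAvg x t i) = ergodicAvg (fun k => P.A i (x k i)) t := fun i => by
    rw [ergodicAvg_apply]
    exact map_ergodicAvg (P.A i).toLinearMap _ t
  simp only [residual, hA]
  simp only [ergodicAvg, Finset.sum_sub_distrib, Finset.sum_add_distrib, smul_sub, smul_add, ht,
    ← Finset.smul_sum]
  rw [Finset.sum_comm]

theorem Scenario2.objective_ergodicAvg_le (hS : P.Scenario2 γ L) (h : P.IsADMM γ x y lam)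
    (t : ℕ) : P.objective (ergodicAvg x t) (ergodicAvg y t)
      ≤ ergodicAvg (fun k => P.objective (x k) (y k)) t := by
  have h1 : ∀ i, P.f i (ergodicAvg x t i) ≤ ergodicAvg (fun k => P.f i (x k i)) t := fun i => by
    rw [ergodicAvg_apply]
    exact map_ergodicAvg_le (hS.convexOn_X i) (fun k => h.mem k i) t
  have h2 := map_ergodicAvg_le hS.convex_fN (z := y) (fun k => Set.mem_univ _) t
  have h3 := Finset.sum_le_sum fun i (_ : i ∈ Finset.univ) => h1 i
  refine (add_le_add h3 h2).trans_eq ?_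
  simp only [ergodicAvg, objective, Finset.sum_add_distrib, smul_add, ← Finset.smul_sum]
  rw [Finset.sum_comm]

/-- Lagrangian duality at a KKT point. -/
theorem IsKKT.inner_residual_le {xs : (i : Fin (m + 1)) → EuclideanSpace ℝ (Fin (n i))}
    {ys lams : EuclideanSpace ℝ (Fin p)} (hopt : P.IsKKT xs ys lams)
    {u : (i : Fin (m + 1)) → EuclideanSpace ℝ (Fin (n i))} (hu : ∀ i, u i ∈ P.X i)
    (v : EuclideanSpace ℝ (Fin p)) :
    inner ℝ lams (P.residual u v) ≤ P.objective u v - P.objective xs ys := by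
  have key : ∀ {q : ℕ} {f : EuclideanSpace ℝ (Fin q) → ℝ} {X : Set (EuclideanSpace ℝ (Fin q))}
      {A : EuclideanSpace ℝ (Fin q) →L[ℝ] EuclideanSpace ℝ (Fin p)}
      {a : EuclideanSpace ℝ (Fin q)}, BlockOptimal f X A a lams → ∀ z ∈ X,
      inner ℝ lams (A z - A a) ≤ f z - f a := by
    rintro q f X A a ⟨-, g, hg1, hg2⟩ z hz
    have h1 := hg1 z hz
    have h2 := hg2 z hz
    rw [inner_sub_right, ContinuousLinearMap.adjoint_inner_right, real_inner_comm,
      real_inner_comm lams, map_sub] at h2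
    linarith
  have h1 := Finset.sum_le_sum fun i (_ : i ∈ Finset.univ) => key (hopt.block i) (u i) (hu i)
  have h2 := key hopt.last v (Set.mem_univ _)
  have h3 : P.residual u v = ∑ i, (P.A i (u i) - P.A i (xs i))
      + (ContinuousLinearMap.id ℝ _ v - ContinuousLinearMap.id ℝ _ ys) := by
    rw [← sub_zero (P.residual u v), ← hopt.feasible]
    simp only [residual, Finset.sum_sub_distrib, ContinuousLinearMap.id_apply]
    abel
  rw [h3, inner_add_right, inner_sum, objective, objective]
  rw [Finset.sum_sub_distrib] at h1
  linarith

/-- The error `∑_{i ≥ 2} A_i (x_i - x_i^*)` of the blocks `2, …, N`, as seen by the coupling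
constraint. -/
def tailError (P : SharingProblem m p n) (xs : (i : Fin (m + 1)) → EuclideanSpace ℝ (Fin (n i)))
    (ys : EuclideanSpace ℝ (Fin p)) (u : (i : Fin (m + 1)) → EuclideanSpace ℝ (Fin (n i)))
    (v : EuclideanSpace ℝ (Fin p)) : EuclideanSpace ℝ (Fin p) :=
  ∑ i : Fin m, P.A i.succ (u i.succ - xs i.succ) + (v - ys)

/-- The Lagrangian gap at an iterate, for an arbitrary multiplier `μ`. The first two terms
telescope. For two blocks they would be all; the lags of the blocks `2, …, N - 1` contribute the
last term, whose sum is controlled by the length of the trajectory. -/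
theorem IsADMM.objective_sub_le (hS : P.Scenario2 γ L) (h : P.IsADMM γ x y lam)
    {xs : (i : Fin (m + 1)) → EuclideanSpace ℝ (Fin (n i))} {ys : EuclideanSpace ℝ (Fin p)}
    (hxs : ∀ i, xs i ∈ P.X i) (hfeas : P.residual xs ys = 0) {D : ℝ}
    (hD : ∀ k, ∑ i : Fin m, ‖P.A i.succ (xs i.succ) - P.A i.succ (x (k + 1) i.succ)‖ ≤ D)
    (μ : EuclideanSpace ℝ (Fin p)) (k : ℕ) :
    P.objective (x (k + 1)) (y (k + 1)) - P.objective xs ys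
        - inner ℝ μ (P.residual (x (k + 1)) (y (k + 1)))
      ≤ 1 / (2 * γ) * (‖lam k - μ‖ ^ 2 - ‖lam (k + 1) - μ‖ ^ 2)
        + γ / 2 * (‖P.tailError xs ys (x k) (y k)‖ ^ 2
          - ‖P.tailError xs ys (x (k + 1)) (y (k + 1))‖ ^ 2)
        + γ * D * P.stepLength x y lam k := by
  have hγ := hS.gamma_pos
  obtain ⟨l, hl⟩ : ∃ l, l = lam (k + 1) := ⟨_, rfl⟩
  obtain ⟨r, hr⟩ : ∃ r, r = P.residual (x (k + 1)) (y (k + 1)) := ⟨_, rfl⟩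
  obtain ⟨a, ha⟩ : ∃ a, a = P.stepLength x y lam k := ⟨_, rfl⟩
  obtain ⟨e, he⟩ : ∃ e : Fin (m + 1) → EuclideanSpace ℝ (Fin p),
    ∀ i, e i = P.A i (x (k + 1) i) - P.A i (xs i) := ⟨_, fun _ => rfl⟩
  obtain ⟨E, hE⟩ : ∃ E, E = P.tailError xs ys (x (k + 1)) (y (k + 1)) := ⟨_, rfl⟩
  obtain ⟨V, hV⟩ : ∃ V, V = P.lag x y k 0 := ⟨_, rfl⟩
  have hlam : lam k = l + γ • r := by rw [hl, hr, h.update_lam]; abel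
  have hEk : P.tailError xs ys (x k) (y k) = E - V := by
    rw [hE, hV, lag, Fin.sum_Ioi_zero]
    simp only [tailError, map_sub, Finset.sum_sub_distrib]
    abel
  have her : r = ∑ i, e i + (y (k + 1) - ys) := by
    rw [hr, ← sub_zero (P.residual (x (k + 1)) _), ← hfeas]
    simp only [he, residual, Finset.sum_sub_distrib]
    abel
  have he0 : e 0 = r - E := by
    rw [her, Fin.sum_univ_succ, hE, tailError]
    simp only [map_sub, ← he]
    abel
  have hD0 : 0 ≤ D := (Finset.sum_nonneg fun _ _ => norm_nonneg _).trans (hD k)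
  have ha0 : 0 ≤ a := ha ▸ stepLength_nonneg P x y lam k
  have hb : ∑ i, P.f i (x (k + 1) i) - ∑ i, P.f i (xs i)
      ≤ inner ℝ l (∑ i, e i) + γ * ∑ i, inner ℝ (P.lag x y k i) (e i) := by
    rw [inner_sum, Finset.mul_sum, ← Finset.sum_add_distrib, ← Finset.sum_sub_distrib]
    refine Finset.sum_le_sum fun i _ => ?_
    have := h.block_le hS k i (hxs i)
    rw [← hl, show P.A i (xs i - x (k + 1) i) = -e i by rw [map_sub, he, neg_sub],
      inner_neg_right, inner_add_left, real_inner_smul_left] at this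
    linarith
  have hN := h.last_le hS k ys
  rw [← hl, ← neg_sub, inner_neg_right] at hN
  have htail : ∑ i : Fin m, inner ℝ (P.lag x y k i.succ) (e i.succ) ≤ D * a := by
    have h1 : ∀ i : Fin m, inner ℝ (P.lag x y k i.succ) (e i.succ)
        ≤ ‖P.A i.succ (xs i.succ) - P.A i.succ (x (k + 1) i.succ)‖ * a := by
      intro i
      refine (real_inner_le_norm _ _).trans ?_
      rw [he, norm_sub_rev, mul_comm]
      refine mul_le_mul_of_nonneg_left ?_ (norm_nonneg _)
      have := norm_lag_add_le_stepLength P x y lam k i.succ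
      linarith [norm_nonneg (lam k - lam (k + 1))]
    refine (Finset.sum_le_sum fun i _ => h1 i).trans ?_
    rw [← Finset.sum_mul]
    exact mul_le_mul_of_nonneg_right (hD k) ha0
  have hhead : inner ℝ (P.lag x y k 0) (e 0) = inner ℝ V r - inner ℝ V E := by
    rw [← hV, he0, inner_sub_right]
  rw [Fin.sum_univ_succ fun i => inner ℝ (P.lag x y k i) (e i), hhead] at hb
  have hlr : inner ℝ l r = inner ℝ l (∑ i, e i) + inner ℝ l (y (k + 1) - ys) := by
    conv_lhs => rw [her]
    rw [inner_add_right]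
  have hVr : 2 * inner ℝ V r ≤ ‖V‖ ^ 2 + ‖r‖ ^ 2 := by
    have := norm_sub_sq_real V r
    nlinarith [sq_nonneg ‖V - r‖]
  have hdual : 1 / (2 * γ) * (‖lam k - μ‖ ^ 2 - ‖l - μ‖ ^ 2)
      = inner ℝ l r - inner ℝ μ r + γ / 2 * ‖r‖ ^ 2 := by
    rw [hlam, show l + γ • r - μ = (l - μ) + γ • r by abel, norm_add_sq_real,
      real_inner_smul_right, inner_sub_left, norm_smul, mul_pow, Real.norm_eq_abs, sq_abs]
    field_simp
    ring
  have hprim : ‖E - V‖ ^ 2 - ‖E‖ ^ 2 = ‖V‖ ^ 2 - 2 * inner ℝ V E := by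
    rw [norm_sub_sq_real, real_inner_comm]; ring
  rw [← hl, hdual, hEk, ← hE, hprim, ← hr, ← ha, objective, objective]
  have h1 := mul_le_mul_of_nonneg_left htail hγ.le
  have h2 := mul_le_mul_of_nonneg_left hVr hγ.le
  linarith

/-- The ergodic Lagrangian gap, for an arbitrary multiplier `μ`. -/
theorem IsADMM.objective_ergodicAvg_sub_le (hS : P.Scenario2 γ L) (h : P.IsADMM γ x y lam)
    {xs : (i : Fin (m + 1)) → EuclideanSpace ℝ (Fin (n i))} {ys : EuclideanSpace ℝ (Fin p)}
    (hxs : ∀ i, xs i ∈ P.X i) (hfeas : P.residual xs ys = 0) {D : ℝ}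
    (hD : ∀ k, ∑ i : Fin m, ‖P.A i.succ (xs i.succ) - P.A i.succ (x (k + 1) i.succ)‖ ≤ D)
    (μ : EuclideanSpace ℝ (Fin p)) (t : ℕ) :
    P.objective (ergodicAvg x t) (ergodicAvg y t) - P.objective xs ys
        - inner ℝ μ (P.residual (ergodicAvg x t) (ergodicAvg y t))
      ≤ (1 / (2 * γ) * ‖lam 0 - μ‖ ^ 2 + γ / 2 * ‖P.tailError xs ys (x 0) (y 0)‖ ^ 2
        + γ * D * ∑' k, P.stepLength x y lam k) / ((t : ℝ) + 1) := by
  have hγ := hS.gamma_pos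
  have ht : (0 : ℝ) < t + 1 := by positivity
  have hD0 : 0 ≤ D := (Finset.sum_nonneg fun _ _ => norm_nonneg _).trans (hD 0)
  have h1 := Finset.sum_le_sum fun k (_ : k ∈ Finset.range (t + 1)) =>
    h.objective_sub_le hS hxs hfeas hD μ k
  rw [Finset.sum_add_distrib, Finset.sum_add_distrib, ← Finset.mul_sum, ← Finset.mul_sum,
    ← Finset.mul_sum, Finset.sum_range_sub', Finset.sum_range_sub', Finset.sum_sub_distrib,
    Finset.sum_sub_distrib, Finset.sum_const, Finset.card_range, nsmul_eq_mul,
    ← inner_sum] at h1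
  push_cast at h1
  have h2 := (h.summable_stepLength hS).sum_le_tsum (Finset.range (t + 1))
    fun k _ => stepLength_nonneg P x y lam k
  have h3 := mul_le_mul_of_nonneg_left h2 (mul_nonneg hγ.le hD0)
  have h4 := hS.objective_ergodicAvg_le h t
  have hμ : inner ℝ μ (ergodicAvg (fun k => P.residual (x k) (y k)) t) = 1 / ((t : ℝ) + 1) *
      inner ℝ μ (∑ k ∈ Finset.range (t + 1), P.residual (x (k + 1)) (y (k + 1))) := by
    rw [ergodicAvg, inner_smul_right]
  change _ ≤ 1 / ((t : ℝ) + 1) * ∑ k ∈ Finset.range (t + 1), _ at h4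
  rw [residual_ergodicAvg, hμ, le_div_iff₀ ht]
  have h5 := mul_le_mul_of_nonneg_right h4 ht.le
  have h6 : ∀ s : ℝ, 1 / ((t : ℝ) + 1) * s * (t + 1) = s := fun s => by field_simp
  rw [h6] at h5
  rw [sub_mul, sub_mul, h6]
  have h7 : 0 ≤ 1 / (2 * γ) * ‖lam (t + 1) - μ‖ ^ 2 := by positivity
  have h8 : 0 ≤ γ / 2 * ‖P.tailError xs ys (x (t + 1)) (y (t + 1))‖ ^ 2 := by positivity
  linarith

/-- The exact penalty gap at the ergodic average: the multiplier is chosen, in the ball of radius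
`ρ`, opposite to the averaged residual. -/
theorem IsADMM.objective_ergodicAvg_add_le (hS : P.Scenario2 γ L) (h : P.IsADMM γ x y lam)
    {xs : (i : Fin (m + 1)) → EuclideanSpace ℝ (Fin (n i))} {ys : EuclideanSpace ℝ (Fin p)}
    (hxs : ∀ i, xs i ∈ P.X i) (hfeas : P.residual xs ys = 0) {D : ℝ}
    (hD : ∀ k, ∑ i : Fin m, ‖P.A i.succ (xs i.succ) - P.A i.succ (x (k + 1) i.succ)‖ ≤ D)
    {ρ : ℝ} (hρ : 0 ≤ ρ) (t : ℕ) :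
    P.objective (ergodicAvg x t) (ergodicAvg y t) - P.objective xs ys
        + ρ * ‖P.residual (ergodicAvg x t) (ergodicAvg y t)‖
      ≤ ((ρ ^ 2 + ‖lam 0‖ ^ 2) / γ + γ / 2 * ‖P.tailError xs ys (x 0) (y 0)‖ ^ 2
        + γ * D * ∑' k, P.stepLength x y lam k) / ((t : ℝ) + 1) := by
  have hγ := hS.gamma_pos
  set r := P.residual (ergodicAvg x t) (ergodicAvg y t) with hr
  have hgap := h.objective_ergodicAvg_sub_le hS hxs hfeas hD (-((ρ / ‖r‖) • r)) t
  have hμ : ‖-((ρ / ‖r‖) • r)‖ ≤ ρ := by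
    rw [norm_neg, norm_smul, Real.norm_of_nonneg (by positivity)]
    rcases eq_or_ne ‖r‖ 0 with h0 | h0
    · simpa [h0] using hρ
    · exact (div_mul_cancel₀ ρ h0).le
  have hin : inner ℝ (-((ρ / ‖r‖) • r)) r = -(ρ * ‖r‖) := by
    rw [inner_neg_left, real_inner_smul_left, real_inner_self_eq_norm_sq]
    rcases eq_or_ne ‖r‖ 0 with h0 | h0
    · simp [h0]
    · field_simp
  rw [← hr, hin, sub_neg_eq_add] at hgap
  refine hgap.trans (div_le_div_of_nonneg_right ?_ (by positivity))
  gcongr ?_ + _ + _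
  have h1 : ‖lam 0 - -((ρ / ‖r‖) • r)‖ ≤ ‖lam 0‖ + ρ :=
    (norm_sub_le _ _).trans (by gcongr)
  have h2 := pow_le_pow_left₀ (norm_nonneg _) h1 2
  rw [one_div_mul_eq_div, div_le_div_iff₀ (by positivity) hγ]
  nlinarith [sq_nonneg (‖lam 0‖ - ρ)]

end SharingProblem

end

/-- Blocks `2, …, N - 1` are the indices `i.succ` with `i : Fin m`; `G` is the total length
`∑' k, P.stepLength x y lam k` of the trajectory, whose finiteness is part of the conclusion. -/
theorem mainTheorem4 (m p : ℕ) (n : Fin (m + 1) → ℕ) (P : SharingProblem m p n)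
    (γ : ℝ) (L : ℝ≥0) (hS : P.Scenario2 γ L)
    (x : ℕ → (i : Fin (m + 1)) → EuclideanSpace ℝ (Fin (n i)))
    (y lam : ℕ → EuclideanSpace ℝ (Fin p)) (hADMM : P.IsADMM γ x y lam)
    (xs : (i : Fin (m + 1)) → EuclideanSpace ℝ (Fin (n i)))
    (ys lams : EuclideanSpace ℝ (Fin p)) (hopt : P.IsKKT xs ys lams)
    (ρ : ℝ) (hρ : ρ = ‖lams‖ + 1) :
    Summable (P.stepLength x y lam) ∧
    (∃ D : ℝ, ∀ k, ∑ i : Fin m, ‖P.A i.succ (xs i.succ) - P.A i.succ (x (k + 1) i.succ)‖ ≤ D) ∧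
    ∀ D : ℝ,
      (∀ k, ∑ i : Fin m, ‖P.A i.succ (xs i.succ) - P.A i.succ (x (k + 1) i.succ)‖ ≤ D) →
      ∀ G : ℝ, G = ∑' k, P.stepLength x y lam k →
      ∀ C : ℝ, C = (ρ ^ 2 + ‖lam 0‖ ^ 2) / γ
          + γ / 2 * ‖∑ i : Fin m, P.A i.succ (x 0 i.succ - xs i.succ) + (y 0 - ys)‖ ^ 2
          + γ * D * G →
      (∀ t : ℕ,
        0 ≤ P.objective (SharingProblem.ergodicAvg x t) (SharingProblem.ergodicAvg y t)
              - P.objective xs ys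
            + ρ * ‖P.residual (SharingProblem.ergodicAvg x t) (SharingProblem.ergodicAvg y t)‖ ∧
        P.objective (SharingProblem.ergodicAvg x t) (SharingProblem.ergodicAvg y t)
              - P.objective xs ys
            + ρ * ‖P.residual (SharingProblem.ergodicAvg x t) (SharingProblem.ergodicAvg y t)‖
          ≤ C / ((t : ℝ) + 1)) ∧
      ∀ ε : ℝ, 0 < ε → ∀ t : ℕ, ρ * C / ε ≤ (t : ℝ) + 1 →
        |P.objective (SharingProblem.ergodicAvg x t) (SharingProblem.ergodicAvg y t)
            - P.objective xs ys| ≤ ε ∧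
        ‖P.residual (SharingProblem.ergodicAvg x t) (SharingProblem.ergodicAvg y t)‖ ≤ ε := by
  have hsum := hADMM.summable_stepLength hS
  have hxs : ∀ i, xs i ∈ P.X i := fun i => (hopt.block i).1
  refine ⟨hsum, ?_, ?_⟩
  · obtain ⟨R, hR⟩ := hADMM.exists_norm_le hS
    refine ⟨∑ i : Fin m, (‖P.A i.succ (xs i.succ)‖ + ‖P.A i.succ‖ * R), fun k =>
      Finset.sum_le_sum fun i _ => (norm_sub_le _ _).trans ?_⟩
    gcongr
    exact (P.A i.succ).le_opNorm_of_le ((hR k).1 _)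
  rintro D hD G rfl C hC
  have hρ1 : 1 ≤ ρ := by rw [hρ]; linarith [norm_nonneg lams]
  have hlow : ∀ t, -(‖lams‖ * ‖P.residual (SharingProblem.ergodicAvg x t)
        (SharingProblem.ergodicAvg y t)‖)
      ≤ P.objective (SharingProblem.ergodicAvg x t) (SharingProblem.ergodicAvg y t)
        - P.objective xs ys := by
    intro t
    have hmem : ∀ i, SharingProblem.ergodicAvg x t i ∈ P.X i := fun i => by
      rw [SharingProblem.ergodicAvg_apply]
      exact SharingProblem.ergodicAvg_mem (hS.convex_X i) (fun k => hADMM.mem k i) t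
    exact (neg_le_of_abs_le (abs_real_inner_le_norm _ _)).trans (hopt.inner_residual_le hmem _)
  have hup : ∀ t : ℕ,
      P.objective (SharingProblem.ergodicAvg x t) (SharingProblem.ergodicAvg y t)
          - P.objective xs ys
          + ρ * ‖P.residual (SharingProblem.ergodicAvg x t) (SharingProblem.ergodicAvg y t)‖
        ≤ C / ((t : ℝ) + 1) := fun t => by
    rw [hC]
    exact hADMM.objective_ergodicAvg_add_le hS hxs hopt.feasible hD (zero_le_one.trans hρ1) t
  refine ⟨fun t => ⟨?_, hup t⟩, fun ε hε t ht => ?_⟩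
  · have h1 := hlow t
    have h2 := norm_nonneg (P.residual (SharingProblem.ergodicAvg x t)
      (SharingProblem.ergodicAvg y t))
    rw [hρ]
    linarith
  · have h1 := hlow t
    have h2 := hup t
    set r := ‖P.residual (SharingProblem.ergodicAvg x t) (SharingProblem.ergodicAvg y t)‖
    set g := P.objective (SharingProblem.ergodicAvg x t) (SharingProblem.ergodicAvg y t)
      - P.objective xs ys
    have hr : 0 ≤ r := norm_nonneg _
    have hρ0 : 0 < ρ := zero_lt_one.trans_le hρ1
    have hC' : C / ((t : ℝ) + 1) ≤ ε / ρ := by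
      rw [div_le_iff₀ hε] at ht
      rw [div_le_div_iff₀ (by positivity) hρ0]
      linarith
    have hερ : ε / ρ * ρ = ε := div_mul_cancel₀ _ hρ0.ne'
    have hερ0 : 0 < ε / ρ := by positivity
    have hl : ‖lams‖ = ρ - 1 := by rw [hρ]; ring
    rw [hl] at h1
    -- Since `ρ - ‖λ*‖ = 1`, the penalty gap bounds the averaged residual itself.
    have hrε : r ≤ ε / ρ := by linarith
    have h3 : (ρ - 1) * r ≤ (ρ - 1) * (ε / ρ) :=
      mul_le_mul_of_nonneg_left hrε (by linarith)
    have h4 : ε / ρ ≤ ε := div_le_self hε.le hρ1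
    refine ⟨abs_le.2 ⟨by linarith, ?_⟩, hrε.trans h4⟩
    have : 0 ≤ ρ * r := by positivity
    linarith
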